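/- For $0<s<1$ and $u\in L^2(\mathbb R^2)$ put $$[u]_{W^{s,2}(\mathbb R^2)}^2=\iint_{\mathbb R^2\times\mathbb R^2}\frac{|u(x)-u(y)|^2}{|x-y|^{2+2s}}\,dx\,dy,$$ let $W^{s,2}(\mathbb R^2)$ be the space of real-valued $u\in L^2(\mathbb R^2)$ with $[u]_{W^{s,2}(\mathbb R^2)}<\infty$, normed by $\|u\|_{L^2(\mathbb R^2)}+[u]_{W^{s,2}(\mathbb R^2)}$, and for an open set $\Omega\subset\mathbb R^2$ let $\widetilde W^{s,2}_0(\Omega)$ be the closure of $C_0^\infty(\Omega)$ in $W^{s,2}(\mathbb R^2)$. Define $$\lambda_1^s(\Omega)=\inf_{u\in\widetilde W^{s,2}_0(\Omega)\setminus\{0\}}\frac{[u]^2_{W^{s,2}(\mathbb R^2)}}{\|u\|^2_{L^2(\Omega)}},\qquad r_\Omega=\sup\{\rho>0:\ \exists\,x\in\Omega \text{ with } B_\rho(x)\subset\Omega\}\in[0,+\infty].$$ Let $\Theta=\mathbb R^2\setminus\Sigma$, where $\Sigma=\bigcup_{i\in\mathbb Z}\{(x,i)\in\mathbb R^2: |x|\ge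 1\}$. A simply connected set is understood to be nonempty and path-connected. Then: 1. If $1/2<s<1$, then for every open simply connected $\Omega\subset\mathbb R^2$: $\lambda_1^s(\Omega)>0$ if and only if $r_\Omega<+\infty$. 2. If $0<s\le 1/2$, then for every open simply connected $\Omega\subset\mathbb R^2$: $\lambda_1^s(\Omega)>0$ implies $r_\Omega<+\infty$. The converse fails: for each such $s$ it is not true that every open simply connected $\Omega\subset\mathbb R^2$ with $r_\Omega<+\infty$ has $\lambda_1^s(\Omega)>0$. 3. The set $\Theta$ is open and simply connected, $r_\Theta<+\infty$, and $\lambda_1^s(\Theta)=0$ for every $0<s\le 1/2$. -/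

import Mathlib

open MeasureTheory Set
open scoped ENNReal

noncomputable section

/-- The Gagliardo-Slobodeckii seminorm
`[u]_{W^{s,2}(ℝ^N)} = (∬ |u x - u y|² / |x - y|^(N + 2 s) dx dy)^(1/2)`,
with values in `[0, ∞]`. (On the diagonal the integrand is `0 / 0 = 0`.) -/
def gagliardoSeminorm {N : ℕ} (s : ℝ) (u : EuclideanSpace ℝ (Fin N) → ℝ) : ℝ≥0∞ :=
  (∫⁻ p : EuclideanSpace ℝ (Fin N) × EuclideanSpace ℝ (Fin N),
    ‖u p.1 - u p.2‖ₑ ^ 2 / ‖p.1 - p.2‖ₑ ^ ((N : ℝ) + 2 * s)) ^ (1 / 2 : ℝ)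

/-- `u` (a representative of) an element of `W^{s,2}(ℝ^N)`: square integrable, finite seminorm. -/
def MemFracSobolev {N : ℕ} (s : ℝ) (u : EuclideanSpace ℝ (Fin N) → ℝ) : Prop :=
  MemLp u 2 volume ∧ gagliardoSeminorm s u < ⊤

/-- The norm `‖u‖_{L²(ℝ^N)} + [u]_{W^{s,2}(ℝ^N)}` of `W^{s,2}(ℝ^N)`. -/
def fracSobolevNorm {N : ℕ} (s : ℝ) (u : EuclideanSpace ℝ (Fin N) → ℝ) : ℝ≥0∞ :=
  eLpNorm u 2 volume + gagliardoSeminorm s u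

/-- `φ ∈ C^∞_0(Ω)`: smooth, with compact support contained in `Ω`. -/
def IsTestFunctionOn {N : ℕ} (Ω : Set (EuclideanSpace ℝ (Fin N)))
    (φ : EuclideanSpace ℝ (Fin N) → ℝ) : Prop :=
  ContDiff ℝ (⊤ : ℕ∞) φ ∧ HasCompactSupport φ ∧ tsupport φ ⊆ Ω

/-- `u` belongs to the closure of `C^∞_0(Ω)` in `W^{s,2}(ℝ^N)`. -/
def MemFracSobolevZero {N : ℕ} (s : ℝ) (Ω : Set (EuclideanSpace ℝ (Fin N)))
    (u : EuclideanSpace ℝ (Fin N) → ℝ) : Prop :=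
  MemFracSobolev s u ∧
    ∀ ε : ℝ≥0∞, 0 < ε → ∃ φ, IsTestFunctionOn Ω φ ∧ fracSobolevNorm s (u - φ) < ε

/-- `λ₁^s(Ω)`, the infimum of `[u]²_{W^{s,2}(ℝ^N)} / ‖u‖²_{L²(Ω)}` over the nonzero elements of the
closure of `C^∞_0(Ω)` in `W^{s,2}(ℝ^N)`, with values in `[0, ∞]` (nonzero as an element of `L²`,
that is, not almost everywhere zero). -/
def fracEigenvalue {N : ℕ} (s : ℝ) (Ω : Set (EuclideanSpace ℝ (Fin N))) : ℝ≥0∞ :=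
  ⨅ u ∈ {u : EuclideanSpace ℝ (Fin N) → ℝ | MemFracSobolevZero s Ω u ∧ ¬ u =ᵐ[volume] 0},
    gagliardoSeminorm s u ^ 2 / eLpNorm u 2 (volume.restrict Ω) ^ 2

/-- The inradius `sup {ρ > 0 : ∃ x ∈ Ω, B_ρ(x) ⊆ Ω}`, with values in `[0, ∞]`. -/
def inradius {N : ℕ} (Ω : Set (EuclideanSpace ℝ (Fin N))) : ℝ≥0∞ :=
  ⨆ ρ ∈ {ρ : ℝ | 0 < ρ ∧ ∃ x ∈ Ω, Metric.ball x ρ ⊆ Ω}, ENNReal.ofReal ρ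

/-- The infinite comb: all points `(x, i)` of the plane with `i` an integer and `|x| ≥ 1`. -/
def infiniteComb : Set (EuclideanSpace ℝ (Fin 2)) :=
  ⋃ i : ℤ, {p | 1 ≤ |p 0| ∧ p 1 = (i : ℝ)}

/-- The infinite complement comb `Θ`. -/
def complementComb : Set (EuclideanSpace ℝ (Fin 2)) := infiniteCombᶜ

end

/-!
# Fractional Makai–Hayman inequality for simply connected planar sets

**Infinite inradius.** Dilating a fixed bump by `ρ` multiplies its Rayleigh quotient by `ρ^(-2s)`.
If `Ω` contains arbitrarily large balls, these bumps are test functions on `Ω`, so `λ₁^s(Ω) = 0`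
(`inradius_lt_top_of_fracEigenvalue_pos`); this needs no topology and
holds for all `0 < s < 1`.

**Positivity for `s > 1/2`.** If `Ω` is simply connected, open, and omits `p`, then no circle around
`p` lies in `Ω`: a continuous logarithm of `z - p` on `Ω` would contradict `∮ dz / (z - p) = 2πi`
(`exists_circle_notMem_of_isSimplyConnected`). So a test function on `Ω` vanishes somewhere on each
circle around `p`. In polar coordinates `(t, θ)`, chains of averages over rectangles shrinking by
the factor `2` connect any two points with the same `t`. The square of the `k`-th link is at most a
constant times `2^(k(2-2s))` times the energy of a strip of width `2^(-k)` in `t`, which does not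
depend on `θ`, and integration in `t` gains a factor `2^(-k)`. After Cauchy–Schwarz the resulting
series is geometric with ratio `2^(1/2-s)`, which is where `s > 1/2` enters
(`exists_rectangle_poincare`). This gives a Poincaré inequality on annuli around points of the
complement. When the inradius is finite, every ball of a fixed radius is contained in an annulus of
this kind whose size is bounded, and integrating over the centre of the ball yields the global
inequality (`exists_poincare_of_isSimplyConnected`), which passes to the closure of the test
functions.

**The complement comb for `s ≤ 1/2`.** The set `Θ` is contractible and contains no ball of radius
greater than `3`. A point of the line has zero capacity for the one-dimensional energy of order
`s ≤ 1/2`: averaging a cutoff with a very concentrated copy of itself nearly halves the energy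
(`exists_isPointCutoff_energy_le`). The planar energy of a function of the second coordinate,
restricted to a slab, is at most a constant times its one-dimensional energy
(`lintegral_slab_energy_le`). Hence an arbitrary bump of the plane can be cut off near the lines
`y = i` at negligible cost, up to a factor in the energy, and `λ₁^s(Θ)` is bounded by a multiple
of the Rayleigh quotients of all large bumps (`fracEigenvalue_complementComb`).
-/

open MeasureTheory Set
open scoped ENNReal

noncomputable section

/-! ### Slobodeckij energies and test functions -/

/-- The Euclidean plane. -/
abbrev Plane := EuclideanSpace ℝ (Fin 2)

/-- The Slobodeckij energy `∬ |u x - u y|² / |x - y|^r dμ(x) dμ(y)` on a normed space. With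
`r = dim + 2 s` it is the square of the `W^{s,2}` seminorm; the general form serves both the plane
and the real line. -/
def slobodeckijEnergy {E : Type*} [NormedAddCommGroup E] [MeasurableSpace E] (μ : Measure E)
    (r : ℝ) (u : E → ℝ) : ℝ≥0∞ :=
  ∫⁻ p : E × E, ‖u p.1 - u p.2‖ₑ ^ 2 / ‖p.1 - p.2‖ₑ ^ r ∂(μ.prod μ)

theorem gagliardoSeminorm_sq {N : ℕ} (s : ℝ) (u : EuclideanSpace ℝ (Fin N) → ℝ) :
    gagliardoSeminorm s u ^ 2 = slobodeckijEnergy volume ((N : ℝ) + 2 * s) u := by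
  unfold gagliardoSeminorm slobodeckijEnergy
  rw [← ENNReal.rpow_natCast, ← ENNReal.rpow_mul]
  norm_num
  rfl

theorem eLpNorm_two_sq {α : Type*} [MeasurableSpace α] (μ : Measure α) (u : α → ℝ) :
    eLpNorm u 2 μ ^ 2 = ∫⁻ x, ‖u x‖ₑ ^ 2 ∂μ := by
  rw [eLpNorm_eq_lintegral_rpow_enorm_toReal (by norm_num) (by norm_num), ← ENNReal.rpow_natCast,
    ← ENNReal.rpow_mul]
  norm_num

theorem ENNReal.add_sq_le_two_mul (a b : ℝ≥0∞) : (a + b) ^ 2 ≤ 2 * a ^ 2 + 2 * b ^ 2 := by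
  have h := ENNReal.rpow_add_le_mul_rpow_add_rpow a b (p := 2) (by norm_num)
  norm_num at h
  rw [mul_add] at h
  exact_mod_cast h

theorem enorm_add_sq_le (a b : ℝ) : ‖a + b‖ₑ ^ 2 ≤ 2 * ‖a‖ₑ ^ 2 + 2 * ‖b‖ₑ ^ 2 :=
  (pow_le_pow_left' (enorm_add_le a b) 2).trans (ENNReal.add_sq_le_two_mul _ _)

section Energy

variable {E : Type*} [NormedAddCommGroup E] [MeasurableSpace E] {μ : Measure E}

theorem aemeasurable_slobodeckij [SFinite μ] [BorelSpace E] [SecondCountableTopology E] {r : ℝ}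
    {u : E → ℝ} (hu : AEMeasurable u μ) :
    AEMeasurable (fun p : E × E => ‖u p.1 - u p.2‖ₑ ^ 2 / ‖p.1 - p.2‖ₑ ^ r) (μ.prod μ) := by
  have h1 : AEMeasurable (fun p : E × E => u p.1) (μ.prod μ) :=
    hu.comp_quasiMeasurePreserving Measure.quasiMeasurePreserving_fst
  have h2 : AEMeasurable (fun p : E × E => u p.2) (μ.prod μ) :=
    hu.comp_quasiMeasurePreserving Measure.quasiMeasurePreserving_snd
  refine ((h1.sub h2).enorm.pow_const 2).div ?_
  exact ((measurable_fst.sub measurable_snd).enorm.pow_const r).aemeasurable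

theorem slobodeckijEnergy_add_le [SFinite μ] [BorelSpace E] [SecondCountableTopology E] {r : ℝ}
    {u : E → ℝ} (v : E → ℝ) (hu : AEMeasurable u μ) :
    slobodeckijEnergy μ r (u + v) ≤ 2 * slobodeckijEnergy μ r u + 2 * slobodeckijEnergy μ r v := by
  unfold slobodeckijEnergy
  rw [← lintegral_const_mul' _ _ (by norm_num), ← lintegral_const_mul' _ _ (by norm_num),
    ← lintegral_add_left' ((aemeasurable_slobodeckij hu).const_mul 2)]
  refine lintegral_mono fun p => ?_
  rw [← mul_div_assoc, ← mul_div_assoc, ← ENNReal.add_div]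
  refine ENNReal.div_le_div_right ?_ _
  have : (u + v) p.1 - (u + v) p.2 = (u p.1 - u p.2) + (v p.1 - v p.2) := by
    simp only [Pi.add_apply]; ring
  rw [this]
  exact enorm_add_sq_le _ _

theorem slobodeckijEnergy_comp_sub [SFinite μ] [BorelSpace E] [SecondCountableTopology E]
    [μ.IsAddRightInvariant] (r : ℝ) (u : E → ℝ) (a : E) :
    slobodeckijEnergy μ r (fun x => u (x - a)) = slobodeckijEnergy μ r u := by
  unfold slobodeckijEnergy
  have h := (measurePreserving_sub_right μ a).prod (measurePreserving_sub_right μ a)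
  have he : MeasurableEmbedding (Prod.map (fun x : E => x - a) (fun x : E => x - a)) :=
    ((Homeomorph.subRight a).prodCongr (Homeomorph.subRight a)).measurableEmbedding
  rw [← h.lintegral_comp_emb he fun p => ‖u p.1 - u p.2‖ₑ ^ 2 / ‖p.1 - p.2‖ₑ ^ r]
  simp

variable [NormedSpace ℝ E] [FiniteDimensional ℝ E] [BorelSpace E]

theorem lintegral_comp_smul_of_pos (μ : Measure E) [μ.IsAddHaarMeasure] (f : E → ℝ≥0∞) {c : ℝ}
    (hc : 0 < c) :
    ∫⁻ x, f (c • x) ∂μ = ENNReal.ofReal c ^ (-(Module.finrank ℝ E : ℝ)) * ∫⁻ x, f x ∂μ := by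
  have he : MeasurableEmbedding (fun x : E => c • x) :=
    (Homeomorph.smulOfNeZero c hc.ne').measurableEmbedding
  rw [← he.lintegral_map, Measure.map_addHaar_smul μ hc.ne', lintegral_smul_measure, smul_eq_mul,
    abs_of_pos (by positivity), ENNReal.ofReal_inv_of_pos (by positivity),
    ENNReal.ofReal_pow hc.le, ENNReal.rpow_neg, ENNReal.rpow_natCast]

theorem slobodeckijEnergy_comp_smul [SecondCountableTopology E] [μ.IsAddHaarMeasure] (r : ℝ)
    (u : E → ℝ) {c : ℝ} (hc : 0 < c) :
    slobodeckijEnergy μ r (fun x => u (c • x)) =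
      ENNReal.ofReal c ^ (r - 2 * Module.finrank ℝ E) * slobodeckijEnergy μ r u := by
  have hc' : ENNReal.ofReal c ≠ 0 := by simpa using hc
  have h := lintegral_comp_smul_of_pos (μ.prod μ)
    (fun p : E × E => ‖u p.1 - u p.2‖ₑ ^ 2 / ‖p.1 - p.2‖ₑ ^ r) hc
  rw [Module.finrank_prod] at h
  unfold slobodeckijEnergy
  have hsub : r - 2 * (Module.finrank ℝ E : ℝ) =
      r + -((Module.finrank ℝ E + Module.finrank ℝ E : ℕ) : ℝ) := by
    push_cast; ring
  rw [hsub, ENNReal.rpow_add _ _ hc' ENNReal.ofReal_ne_top, mul_assoc, ← h,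
    ← lintegral_const_mul' _ _ (by simp [hc'])]
  refine lintegral_congr fun p => ?_
  have hn : ‖(c • p).1 - (c • p).2‖ₑ = ENNReal.ofReal c * ‖p.1 - p.2‖ₑ := by
    rw [Prod.smul_fst, Prod.smul_snd, ← smul_sub, enorm_smul, Real.enorm_eq_ofReal hc.le]
  have hcr : ENNReal.ofReal c ^ r ≠ 0 := by simp [hc']
  have hcr' : ENNReal.ofReal c ^ r ≠ ⊤ := by simp [hc']
  simp only [hn]
  rw [ENNReal.mul_rpow_of_ne_top ENNReal.ofReal_ne_top (by simp), ← mul_div_assoc,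
    ENNReal.mul_div_mul_left _ _ hcr hcr']
  simp

end Energy

section Finite

variable {E : Type*} [NormedAddCommGroup E] [NormedSpace ℝ E] [FiniteDimensional ℝ E]
  [Nontrivial E] [MeasurableSpace E] [BorelSpace E]

theorem lintegral_min_div_rpow_lt_top (μ : Measure E) [μ.IsAddHaarMeasure] {r C L : ℝ}
    (hC : 0 ≤ C) (hr : (Module.finrank ℝ E : ℝ) < r) (hr' : r < Module.finrank ℝ E + 2) :
    ∫⁻ z, ENNReal.ofReal (min C (L ^ 2 * ‖z‖ ^ 2) / ‖z‖ ^ r) ∂μ < ⊤ := by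
  set d := Module.finrank ℝ E
  have hd1 : 1 ≤ d := Module.finrank_pos
  suffices h : Integrable (fun z : E => (fun y : ℝ => min C (L ^ 2 * y ^ 2) / y ^ r) ‖z‖) μ by
    have := h.2
    rw [hasFiniteIntegral_iff_enorm] at this
    refine lt_of_le_of_lt (lintegral_mono fun z => ?_) this
    exact (Real.ofReal_le_enorm _)
  refine (integrable_fun_norm_addHaar (E := E) (F := ℝ) μ
    (f := fun y : ℝ => min C (L ^ 2 * y ^ 2) / y ^ r)).2 ?_
  have hmeas : Measurable fun y : ℝ => y ^ (d - 1) • (min C (L ^ 2 * y ^ 2) / y ^ r) := by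
    fun_prop
  rw [← Ioc_union_Ioi_eq_Ioi (zero_le_one' ℝ)]
  refine IntegrableOn.union ?_ ?_
  · have h1 : IntegrableOn (fun y : ℝ => L ^ 2 * y ^ ((d : ℝ) + 1 - r)) (Ioc 0 1) := by
      have := intervalIntegral.intervalIntegrable_rpow' (a := 0) (b := 1)
        (r := (d : ℝ) + 1 - r) (by linarith)
      rw [intervalIntegrable_iff_integrableOn_Ioc_of_le zero_le_one] at this
      exact this.const_mul _
    refine h1.mono' hmeas.aestronglyMeasurable ?_
    filter_upwards [ae_restrict_mem measurableSet_Ioc] with y hy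
    have hy0 : 0 < y := hy.1
    rw [Real.norm_of_nonneg (by simp only [smul_eq_mul]; positivity)]
    calc y ^ (d - 1) • (min C (L ^ 2 * y ^ 2) / y ^ r)
        ≤ y ^ (d - 1) * ((L ^ 2 * y ^ 2) / y ^ r) := by
          rw [smul_eq_mul]; gcongr; exact min_le_right _ _
      _ = L ^ 2 * y ^ ((d : ℝ) + 1 - r) := by
          have : (d : ℝ) + 1 - r = ((d - 1 + 2 : ℕ) : ℝ) - r := by
            push_cast [Nat.cast_sub hd1]; ring
          rw [this, Real.rpow_sub hy0, Real.rpow_natCast, pow_add]; ring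
  · have h1 : IntegrableOn (fun y : ℝ => C * y ^ ((d : ℝ) - 1 - r)) (Ioi 1) :=
      (integrableOn_Ioi_rpow_of_lt (by linarith) zero_lt_one).const_mul _
    refine h1.mono' hmeas.aestronglyMeasurable ?_
    filter_upwards [ae_restrict_mem measurableSet_Ioi] with y hy
    have hy0 : 0 < y := lt_trans zero_lt_one hy
    rw [Real.norm_of_nonneg (by simp only [smul_eq_mul]; positivity)]
    calc y ^ (d - 1) • (min C (L ^ 2 * y ^ 2) / y ^ r)
        ≤ y ^ (d - 1) * (C / y ^ r) := by
          rw [smul_eq_mul]; gcongr; exact min_le_left _ _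
      _ = C * y ^ ((d : ℝ) - 1 - r) := by
          have : (d : ℝ) - 1 - r = ((d - 1 : ℕ) : ℝ) - r := by
            push_cast [Nat.cast_sub hd1]; ring
          rw [this, Real.rpow_sub hy0, Real.rpow_natCast]; ring

/-- A compactly supported Lipschitz function has finite energy for `dim < r < dim + 2`, that is for
`0 < s < 1`. -/
theorem slobodeckijEnergy_lt_top [SecondCountableTopology E] (μ : Measure E) [μ.IsAddHaarMeasure]
    {r : ℝ} (hr : (Module.finrank ℝ E : ℝ) < r) (hr' : r < Module.finrank ℝ E + 2) {u : E → ℝ}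
    {K : NNReal} (hu : LipschitzWith K u) (hcs : HasCompactSupport u) :
    slobodeckijEnergy μ r u < ⊤ := by
  obtain ⟨M, hM⟩ := hcs.exists_bound_of_continuous hu.continuous
  have hM0 : 0 ≤ M := (norm_nonneg _).trans (hM 0)
  set k : E → ℝ≥0∞ := fun z => ENNReal.ofReal (min ((2 * M) ^ 2) (K ^ 2 * ‖z‖ ^ 2) / ‖z‖ ^ r)
    with hk
  have hkm : Measurable k := by fun_prop
  have hkfin : ∫⁻ z, k z ∂μ < ⊤ := lintegral_min_div_rpow_lt_top μ (by positivity) hr hr'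
  have hneg : ∀ z, k (-z) = k z := by simp [hk]
  set T := tsupport u
  have hTm : MeasurableSet T := (isClosed_tsupport u).measurableSet
  have hbound : ∀ p : E × E, ‖u p.1 - u p.2‖ₑ ^ 2 / ‖p.1 - p.2‖ₑ ^ r ≤
      T.indicator 1 p.1 * k (p.1 - p.2) + T.indicator 1 p.2 * k (p.2 - p.1) := by
    intro p
    by_cases hp : p.1 = p.2
    · simp [hp]
    by_cases hpT : p.1 ∈ T ∨ p.2 ∈ T
    · have hle : ‖u p.1 - u p.2‖ₑ ^ 2 / ‖p.1 - p.2‖ₑ ^ r ≤ k (p.1 - p.2) := by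
        have hn : 0 < ‖p.1 - p.2‖ := norm_pos_iff.2 (sub_ne_zero.2 hp)
        rw [← ofReal_norm, ← ofReal_norm, ← ENNReal.ofReal_pow (norm_nonneg _),
          ENNReal.ofReal_rpow_of_pos hn, ← ENNReal.ofReal_div_of_pos (by positivity)]
        refine ENNReal.ofReal_le_ofReal ?_
        gcongr
        refine le_min ?_ ?_
        · gcongr
          calc ‖u p.1 - u p.2‖ ≤ ‖u p.1‖ + ‖u p.2‖ := norm_sub_le _ _
            _ ≤ 2 * M := by linarith [hM p.1, hM p.2]
        · rw [← mul_pow]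
          gcongr
          simpa [dist_eq_norm] using hu.dist_le_mul p.1 p.2
      have hk' : k (p.2 - p.1) = k (p.1 - p.2) := by rw [← hneg, neg_sub]
      rcases hpT with h | h
      · exact hle.trans (by simp [h])
      · exact hle.trans (by simp [h, hk'])
    · push Not at hpT
      simp [image_eq_zero_of_notMem_tsupport hpT.1, image_eq_zero_of_notMem_tsupport hpT.2]
  have hind : Measurable (T.indicator (1 : E → ℝ≥0∞)) := measurable_one.indicator hTm
  have hA : ∫⁻ p : E × E, T.indicator 1 p.1 * k (p.1 - p.2) ∂(μ.prod μ) < ⊤ := by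
    rw [lintegral_prod _ (by fun_prop)]
    have : ∀ x, ∫⁻ y, T.indicator 1 x * k (x - y) ∂μ = T.indicator 1 x * ∫⁻ z, k z ∂μ := by
      intro x
      rw [lintegral_const_mul _ (by fun_prop), lintegral_sub_left_eq_self]
    simp_rw [this]
    rw [lintegral_mul_const _ hind, lintegral_indicator_one hTm]
    exact ENNReal.mul_lt_top hcs.isCompact.measure_lt_top hkfin
  have hB : ∫⁻ p : E × E, T.indicator 1 p.2 * k (p.2 - p.1) ∂(μ.prod μ) < ⊤ := by
    rw [← lintegral_prod_swap]
    exact hA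
  refine lt_of_le_of_lt (lintegral_mono hbound) ?_
  rw [lintegral_add_left (by fun_prop)]
  exact ENNReal.add_lt_top.2 ⟨hA, hB⟩

end Finite

theorem IsTestFunctionOn.continuous {N : ℕ} {Ω : Set (EuclideanSpace ℝ (Fin N))}
    {ψ : EuclideanSpace ℝ (Fin N) → ℝ} (hψ : IsTestFunctionOn Ω ψ) : Continuous ψ :=
  hψ.1.continuous

theorem IsTestFunctionOn.eq_zero {N : ℕ} {Ω : Set (EuclideanSpace ℝ (Fin N))}
    {ψ : EuclideanSpace ℝ (Fin N) → ℝ} (hψ : IsTestFunctionOn Ω ψ) {x : EuclideanSpace ℝ (Fin N)}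
    (hx : x ∉ Ω) : ψ x = 0 :=
  image_eq_zero_of_notMem_tsupport fun h => hx (hψ.2.2 h)

theorem slobodeckijEnergy_smooth_lt_top {E : Type*} [NormedAddCommGroup E] [NormedSpace ℝ E]
    [FiniteDimensional ℝ E] [Nontrivial E] [MeasurableSpace E] [BorelSpace E]
    [SecondCountableTopology E] (μ : Measure E) [μ.IsAddHaarMeasure]
    {r : ℝ} (hr : (Module.finrank ℝ E : ℝ) < r) (hr' : r < Module.finrank ℝ E + 2) {u : E → ℝ}
    (hu : ContDiff ℝ (⊤ : ℕ∞) u) (hcs : HasCompactSupport u) :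
    slobodeckijEnergy μ r u < ⊤ := by
  have hu1 : ContDiff ℝ 1 u := hu.of_le (by norm_num)
  obtain ⟨K, hK⟩ := hu1.lipschitzWith_of_hasCompactSupport hcs (by norm_num)
  exact slobodeckijEnergy_lt_top μ hr hr' hK hcs

theorem IsTestFunctionOn.energy_lt_top {Ω : Set Plane} {ψ : Plane → ℝ}
    (hψ : IsTestFunctionOn Ω ψ) {s : ℝ} (hs : 0 < s) (hs1 : s < 1) :
    slobodeckijEnergy volume (2 + 2 * s) ψ < ⊤ := by
  refine slobodeckijEnergy_smooth_lt_top volume ?_ ?_ hψ.1 hψ.2.1 <;>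
  · simp only [finrank_euclideanSpace, Fintype.card_fin]
    push_cast
    linarith

theorem IsTestFunctionOn.memFracSobolevZero {Ω : Set Plane} {ψ : Plane → ℝ}
    (hψ : IsTestFunctionOn Ω ψ) {s : ℝ} (hs : 0 < s) (hs1 : s < 1) :
    MemFracSobolevZero s Ω ψ := by
  refine ⟨⟨hψ.continuous.memLp_of_hasCompactSupport hψ.2.1, ?_⟩, fun ε hε => ⟨ψ, hψ, ?_⟩⟩
  · have h := hψ.energy_lt_top hs hs1
    have h2 := gagliardoSeminorm_sq s ψ
    push_cast at h2
    rw [← h2] at h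
    by_contra hcon
    rw [not_lt, top_le_iff] at hcon
    simp [hcon] at h
  · simpa [fracSobolevNorm, gagliardoSeminorm] using hε

/-- The eigenvalue is a Poincaré constant: every test function is a competitor. -/
theorem fracEigenvalue_mul_le {Ω : Set Plane} {ψ : Plane → ℝ}
    (hψ : IsTestFunctionOn Ω ψ) {s : ℝ} (hs : 0 < s) (hs1 : s < 1) :
    fracEigenvalue s Ω * ∫⁻ x, ‖ψ x‖ₑ ^ 2 ≤ slobodeckijEnergy volume (2 + 2 * s) ψ := by
  by_cases h0 : ψ =ᵐ[volume] 0
  · have : ∫⁻ x, ‖ψ x‖ₑ ^ 2 = 0 := by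
      rw [lintegral_congr_ae (g := fun _ => 0)]
      · simp
      · filter_upwards [h0] with x hx
        simp [hx]
    simp [this]
  have hle : fracEigenvalue s Ω ≤
      gagliardoSeminorm s ψ ^ 2 / eLpNorm ψ 2 (volume.restrict Ω) ^ 2 :=
    iInf₂_le ψ ⟨hψ.memFracSobolevZero hs hs1, h0⟩
  have hsupp : eLpNorm ψ 2 (volume.restrict Ω) = eLpNorm ψ 2 volume :=
    eLpNorm_restrict_eq_of_support_subset ((subset_tsupport ψ).trans hψ.2.2)
  rw [hsupp, gagliardoSeminorm_sq, eLpNorm_two_sq] at hle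
  push_cast at hle
  refine (mul_le_mul_left hle _).trans ?_
  exact ENNReal.mul_le_of_le_div le_rfl

/-! ### Scaled bumps and sets of infinite inradius -/

/-- A fixed smooth bump on the plane, supported in the unit ball and nonzero. -/
def planeBump : ContDiffBump (0 : Plane) := ⟨1 / 4, 1 / 2, by norm_num, by norm_num⟩

/-- The bump `planeBump`, rescaled to the ball `B_ρ(a)`. -/
def scaledBump (ρ : ℝ) (a : Plane) (x : Plane) : ℝ := planeBump (ρ⁻¹ • (x - a))

theorem scaledBump_contDiff (ρ : ℝ) (a : Plane) : ContDiff ℝ (⊤ : ℕ∞) (scaledBump ρ a) :=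
  planeBump.contDiff.comp (by fun_prop : ContDiff ℝ (⊤ : ℕ∞) fun x : Plane => ρ⁻¹ • (x - a))

theorem scaledBump_nonneg (ρ : ℝ) (a x : Plane) : 0 ≤ scaledBump ρ a x := planeBump.nonneg

theorem scaledBump_le_one (ρ : ℝ) (a x : Plane) : scaledBump ρ a x ≤ 1 := planeBump.le_one

theorem scaledBump_tsupport {ρ : ℝ} (hρ : 0 < ρ) (a : Plane) :
    tsupport (scaledBump ρ a) ⊆ Metric.closedBall a (ρ / 2) := by
  refine closure_minimal (fun x hx => ?_) Metric.isClosed_closedBall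
  have h : ρ⁻¹ • (x - a) ∈ Function.support planeBump := hx
  rw [planeBump.support_eq, mem_ball_zero_iff, norm_smul, norm_inv, Real.norm_of_nonneg hρ.le,
    inv_mul_lt_iff₀ hρ] at h
  rw [Metric.mem_closedBall, dist_eq_norm]
  have h2 : planeBump.rOut = 1 / 2 := rfl
  rw [h2] at h
  linarith

theorem scaledBump_hasCompactSupport {ρ : ℝ} (hρ : 0 < ρ) (a : Plane) :
    HasCompactSupport (scaledBump ρ a) :=
  (isCompact_closedBall a (ρ / 2)).of_isClosed_subset (isClosed_tsupport _)
    (scaledBump_tsupport hρ a)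

theorem scaledBump_isTestFunctionOn {ρ : ℝ} (hρ : 0 < ρ) {a : Plane} {Ω : Set Plane}
    (h : Metric.ball a ρ ⊆ Ω) : IsTestFunctionOn Ω (scaledBump ρ a) :=
  ⟨scaledBump_contDiff ρ a, scaledBump_hasCompactSupport hρ a,
    ((scaledBump_tsupport hρ a).trans
      (Metric.closedBall_subset_ball (by linarith))).trans h⟩

theorem scaledBump_energy {ρ : ℝ} (hρ : 0 < ρ) (a : Plane) (s : ℝ) :
    slobodeckijEnergy volume (2 + 2 * s) (scaledBump ρ a) =
      ENNReal.ofReal ρ⁻¹ ^ (2 * s - 2) * slobodeckijEnergy volume (2 + 2 * s) planeBump := by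
  have h1 := slobodeckijEnergy_comp_sub (μ := (volume : Measure Plane)) (2 + 2 * s)
    (fun x => planeBump (ρ⁻¹ • x)) a
  have h2 := slobodeckijEnergy_comp_smul (μ := (volume : Measure Plane)) (2 + 2 * s)
    planeBump (inv_pos.2 hρ)
  have h3 : 2 + 2 * s - 2 * ((Module.finrank ℝ Plane : ℕ) : ℝ) = 2 * s - 2 := by
    simp only [finrank_euclideanSpace, Fintype.card_fin]; push_cast; ring
  rw [h3] at h2
  exact h1.trans h2

theorem scaledBump_lintegral {ρ : ℝ} (hρ : 0 < ρ) (a : Plane) :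
    ∫⁻ x, ‖scaledBump ρ a x‖ₑ ^ 2 =
      ENNReal.ofReal ρ⁻¹ ^ (-2 : ℝ) * ∫⁻ x, ‖planeBump x‖ₑ ^ 2 := by
  have h1 := lintegral_sub_right_eq_self (μ := (volume : Measure Plane))
    (fun x => ‖planeBump (ρ⁻¹ • x)‖ₑ ^ 2) a
  have h2 := lintegral_comp_smul_of_pos (volume : Measure Plane) (fun x => ‖planeBump x‖ₑ ^ 2)
    (inv_pos.2 hρ)
  have h3 : -((Module.finrank ℝ Plane : ℕ) : ℝ) = -2 := by
    simp only [finrank_euclideanSpace, Fintype.card_fin]; push_cast; ring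
  rw [h3] at h2
  exact h1.trans h2

theorem planeBump_lintegral_pos : 0 < ∫⁻ x, ‖planeBump x‖ₑ ^ 2 := by
  rw [lintegral_pos_iff_support (planeBump.continuous.measurable.enorm.pow_const 2)]
  have : (Function.support fun x => ‖planeBump x‖ₑ ^ 2) = Function.support planeBump := by
    ext x; simp
  rw [this, planeBump.support_eq]
  exact Metric.measure_ball_pos _ _ planeBump.rOut_pos

theorem planeBump_energy_lt_top {s : ℝ} (hs : 0 < s) (hs1 : s < 1) :
    slobodeckijEnergy volume (2 + 2 * s) planeBump < ⊤ :=
  IsTestFunctionOn.energy_lt_top (Ω := univ)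
    ⟨planeBump.contDiff, planeBump.hasCompactSupport, subset_univ _⟩ hs hs1

/-- By scaling, the Rayleigh quotient of `scaledBump ρ` is of order `ρ^(-2s)`, so a constant that
stays below such quotients up to a factor must vanish. -/
theorem eq_zero_of_mul_scaledBump_le {s : ℝ} (hs : 0 < s) (hs1 : s < 1) {l C : ℝ≥0∞} (hC : C ≠ ⊤)
    (h : ∀ R : ℝ, ∃ ρ a, 0 < ρ ∧ R ≤ ρ ∧ l * ∫⁻ x, ‖scaledBump ρ a x‖ₑ ^ 2 ≤
      C * slobodeckijEnergy volume (2 + 2 * s) (scaledBump ρ a)) : l = 0 := by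
  set I := ∫⁻ x, ‖planeBump x‖ₑ ^ 2
  set e := slobodeckijEnergy volume (2 + 2 * s) planeBump
  have he_top : e ≠ ⊤ := (planeBump_energy_lt_top hs hs1).ne
  have hI0 : I ≠ 0 := planeBump_lintegral_pos.ne'
  have key : ∀ R : ℝ, ∃ ρ, R ≤ ρ ∧ 0 < ρ ∧ l * I ≤ C * e * ENNReal.ofReal (ρ ^ (-(2 * s))) := by
    intro R
    obtain ⟨ρ, a, hρ, hR, hle⟩ := h R
    refine ⟨ρ, hR, hρ, ?_⟩
    have hb : ENNReal.ofReal ρ⁻¹ ≠ 0 := by simpa using hρ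
    have hbt : ENNReal.ofReal ρ⁻¹ ≠ ⊤ := ENNReal.ofReal_ne_top
    rw [scaledBump_lintegral hρ, scaledBump_energy hρ] at hle
    have h2 := mul_le_mul_left hle (ENNReal.ofReal ρ⁻¹ ^ (2 : ℝ))
    have e1 : ENNReal.ofReal ρ⁻¹ ^ (-2 : ℝ) * ENNReal.ofReal ρ⁻¹ ^ (2 : ℝ) = 1 := by
      rw [← ENNReal.rpow_add _ _ hb hbt]; norm_num
    have e2 : ENNReal.ofReal ρ⁻¹ ^ (2 * s - 2) * ENNReal.ofReal ρ⁻¹ ^ (2 : ℝ) =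
        ENNReal.ofReal (ρ ^ (-(2 * s))) := by
      rw [← ENNReal.rpow_add _ _ hb hbt, sub_add_cancel, ENNReal.ofReal_rpow_of_pos (by positivity),
        Real.inv_rpow hρ.le, Real.rpow_neg hρ.le]
    calc l * I = l * (ENNReal.ofReal ρ⁻¹ ^ (-2 : ℝ) * I) * ENNReal.ofReal ρ⁻¹ ^ (2 : ℝ) := by
          rw [mul_assoc, mul_right_comm, e1, one_mul]
      _ ≤ C * (ENNReal.ofReal ρ⁻¹ ^ (2 * s - 2) * e) * ENNReal.ofReal ρ⁻¹ ^ (2 : ℝ) := h2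
      _ = C * e * ENNReal.ofReal (ρ ^ (-(2 * s))) := by rw [← e2]; ring
  have htend : Filter.Tendsto (fun ρ : ℝ => C * e * ENNReal.ofReal (ρ ^ (-(2 * s))))
      Filter.atTop (nhds 0) := by
    have h1 := ENNReal.tendsto_ofReal (tendsto_rpow_neg_atTop (by linarith : 0 < 2 * s))
    have h2 := ENNReal.Tendsto.const_mul (a := C * e) h1
      (Or.inr (ENNReal.mul_ne_top hC he_top))
    simpa using h2
  have hzero : l * I = 0 := by
    by_contra hne
    have hev := (htend.eventually_lt_const (pos_iff_ne_zero.2 hne))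
    obtain ⟨R, hR⟩ := Filter.eventually_atTop.1 hev
    obtain ⟨ρ, hRρ, -, hle⟩ := key R
    exact absurd (hR ρ hRρ) (not_lt.2 hle)
  exact (mul_eq_zero.1 hzero).resolve_right hI0

/-- If `Ω` contains arbitrarily large balls then `λ₁^s(Ω) = 0`. -/
theorem inradius_lt_top_of_fracEigenvalue_pos {Ω : Set Plane} {s : ℝ} (hs : 0 < s) (hs1 : s < 1)
    (h : 0 < fracEigenvalue s Ω) : inradius Ω < ⊤ := by
  by_contra hcon
  rw [not_lt, top_le_iff] at hcon
  refine h.ne' (eq_zero_of_mul_scaledBump_le hs hs1 (C := 1) (by simp) fun R => ?_)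
  have hlt : ENNReal.ofReal R < inradius Ω := by rw [hcon]; exact ENNReal.ofReal_lt_top
  unfold inradius at hlt
  simp only [lt_iSup_iff] at hlt
  obtain ⟨ρ, ⟨hρ, a, -, hball⟩, hRρ⟩ := hlt
  refine ⟨ρ, a, hρ, ?_, ?_⟩
  · exact ((ENNReal.ofReal_lt_ofReal_iff hρ).1 hRρ).le
  · rw [one_mul]
    exact fracEigenvalue_mul_le (scaledBump_isTestFunctionOn hρ hball) hs hs1

/-! ### Circles around omitted points of a simply connected set -/

/-- The point of the plane with coordinates `p.1`, `p.2`. -/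
def toPlane (p : ℝ × ℝ) : Plane := !₂[p.1, p.2]

@[simp] theorem toPlane_zero (p : ℝ × ℝ) : toPlane p 0 = p.1 := rfl

@[simp] theorem toPlane_one (p : ℝ × ℝ) : toPlane p 1 = p.2 := rfl

/-- A continuous logarithm of `z - p` on an open set containing a circle around `p` would be a
primitive of `1 / (z - p)` along that circle, whose integral is `2πi`. Hence a simply connected open
set contains no circle around a point that it omits. -/
theorem not_sphere_subset_of_isSimplyConnected {U : Set ℂ} (hU : IsOpen U)
    (hs : IsSimplyConnected U) {p : ℂ} (hp : p ∉ U) {t : ℝ} (ht : 0 < t) :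
    ¬ Metric.sphere p t ⊆ U := by
  intro hsub
  obtain ⟨f, hfc, hf⟩ := Complex.exists_continuousOn_eqOn_exp_comp hs hU (g := fun z => z - p)
    (by fun_prop) (by
      rintro ⟨z, hz, hzp⟩
      exact hp (by rwa [sub_eq_zero.1 hzp] at hz))
  have hderiv : ∀ z ∈ Metric.sphere p t,
      HasDerivWithinAt f ((fun z => (z - p)⁻¹) z) (Metric.sphere p t) z := by
    intro z hz
    have hzU : z ∈ U := hsub hz
    have hexp : Complex.exp (f z) = z - p := hf hzU
    have hne : z - p ≠ 0 := by rw [← hexp]; exact Complex.exp_ne_zero _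
    have h1 : HasDerivAt (fun w => Complex.exp w + p) (z - p) (f z) := by
      rw [← hexp]
      exact (Complex.hasDerivAt_exp (f z)).add_const p
    refine (HasDerivAt.of_local_left_inverse (hfc.continuousAt (hU.mem_nhds hzU)) h1 hne
      ?_).hasDerivWithinAt
    filter_upwards [hU.mem_nhds hzU] with w hw
    have : Complex.exp (f w) = w - p := hf hw
    rw [this, sub_add_cancel]
  have h0 := circleIntegral.integral_eq_zero_of_hasDerivWithinAt ht.le hderiv
  rw [circleIntegral.integral_sub_inv_of_mem_ball (Metric.mem_ball_self ht)] at h0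
  exact Complex.two_pi_I_ne_zero h0

theorem exists_circle_notMem_of_isSimplyConnected {Ω : Set Plane} (hΩ : IsOpen Ω)
    (hs : IsSimplyConnected Ω) {p : Plane} (hp : p ∉ Ω) {t : ℝ} (ht : 0 < t) :
    ∃ θ ∈ Icc (-Real.pi) Real.pi, p + toPlane (t * Real.cos θ, t * Real.sin θ) ∉ Ω := by
  set e := Complex.orthonormalBasisOneI.repr with he
  have hU : IsOpen (e ⁻¹' Ω) := hΩ.preimage e.continuous
  have hsU : IsSimplyConnected (e ⁻¹' Ω) :=
    (e.toHomeomorph.isSimplyConnected_preimage (s := Ω)).2 hs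
  have hpU : e.symm p ∉ e ⁻¹' Ω := by simpa using hp
  have h := not_sphere_subset_of_isSimplyConnected hU hsU hpU ht
  rw [not_subset] at h
  obtain ⟨z, hz, hzU⟩ := h
  refine ⟨Complex.arg (z - e.symm p), ⟨(Complex.neg_pi_lt_arg _).le, Complex.arg_le_pi _⟩, ?_⟩
  have hn : ‖z - e.symm p‖ = t := by simpa [dist_eq_norm] using hz
  have hcos : t * Real.cos (Complex.arg (z - e.symm p)) = (z - e.symm p).re := by
    rw [← hn, Complex.norm_mul_cos_arg]
  have hsin : t * Real.sin (Complex.arg (z - e.symm p)) = (z - e.symm p).im := by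
    rw [← hn, Complex.norm_mul_sin_arg]
  rw [hcos, hsin]
  have hrepr : toPlane ((z - e.symm p).re, (z - e.symm p).im) = e (z - e.symm p) := by
    ext i
    fin_cases i <;> simp [he, toPlane, Complex.orthonormalBasisOneI_repr_apply]
  rw [hrepr, map_sub, e.apply_symm_apply, add_sub_cancel]
  exact hzU

/-! ### Chains of averages on a rectangle -/

/-- The Slobodeckij energy localised to `A × A`. -/
def slobodeckijEnergyOn {E : Type*} [NormedAddCommGroup E] [MeasurableSpace E] (μ : Measure E)
    (r : ℝ) (A : Set E) (u : E → ℝ) : ℝ≥0∞ :=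
  ∫⁻ p in A ×ˢ A, ‖u p.1 - u p.2‖ₑ ^ 2 / ‖p.1 - p.2‖ₑ ^ r ∂(μ.prod μ)

theorem enorm_sub_integral_sq_le {α : Type*} [MeasurableSpace α] (P : Measure α)
    [IsProbabilityMeasure P] {g : α → ℝ} (hg : Integrable g P) (c : ℝ) :
    ‖c - ∫ x, g x ∂P‖ₑ ^ 2 ≤ ∫⁻ x, ‖c - g x‖ₑ ^ 2 ∂P := by
  have h1 : c - ∫ x, g x ∂P = ∫ x, (c - g x) ∂P := by
    rw [integral_sub (integrable_const c) hg]; simp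
  have hm : AEStronglyMeasurable (fun x => c - g x) P :=
    aestronglyMeasurable_const.sub hg.aestronglyMeasurable
  rw [h1, ← eLpNorm_two_sq]
  refine pow_le_pow_left' ((enorm_integral_le_lintegral_enorm _).trans ?_) 2
  rw [← eLpNorm_one_eq_lintegral_enorm]
  exact eLpNorm_le_eLpNorm_of_exponent_le (by norm_num) hm

theorem enorm_setAverage_sub_setAverage_sq_le {α : Type*} [MeasurableSpace α] {μ : Measure α}
    [SFinite μ] {A B : Set α} (hA : μ A ≠ 0) (hA' : μ A ≠ ⊤) (hB : μ B ≠ 0) (hB' : μ B ≠ ⊤)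
    {v : α → ℝ} (hv : Measurable v) (hvA : IntegrableOn v A μ) (hvB : IntegrableOn v B μ) :
    ‖(⨍ x in A, v x ∂μ) - ⨍ x in B, v x ∂μ‖ₑ ^ 2 ≤
      (μ A)⁻¹ * (μ B)⁻¹ * ∫⁻ p in A ×ˢ B, ‖v p.1 - v p.2‖ₑ ^ 2 ∂(μ.prod μ) := by
  have hPA : IsProbabilityMeasure ((μ A)⁻¹ • μ.restrict A) := by
    constructor
    simp [ENNReal.inv_mul_cancel hA hA']
  have hPB : IsProbabilityMeasure ((μ B)⁻¹ • μ.restrict B) := by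
    constructor
    simp [ENNReal.inv_mul_cancel hB hB']
  have hmA : (⨍ x in A, v x ∂μ) = ∫ x, v x ∂((μ A)⁻¹ • μ.restrict A) := by
    rw [average, Measure.restrict_apply_univ]
  have hmB : (⨍ x in B, v x ∂μ) = ∫ x, v x ∂((μ B)⁻¹ • μ.restrict B) := by
    rw [average, Measure.restrict_apply_univ]
  have hiA : Integrable v ((μ A)⁻¹ • μ.restrict A) :=
    Integrable.smul_measure hvA (ENNReal.inv_ne_top.2 hA)
  have hiB : Integrable v ((μ B)⁻¹ • μ.restrict B) :=
    Integrable.smul_measure hvB (ENNReal.inv_ne_top.2 hB)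
  rw [hmA, hmB, ← enorm_neg, neg_sub]
  refine (enorm_sub_integral_sq_le _ hiA _).trans ?_
  have h2 : ∀ x, ‖(∫ y, v y ∂((μ B)⁻¹ • μ.restrict B)) - v x‖ₑ ^ 2 ≤
      (μ B)⁻¹ * ∫⁻ y in B, ‖v x - v y‖ₑ ^ 2 ∂μ := by
    intro x
    rw [← enorm_neg, neg_sub]
    refine (enorm_sub_integral_sq_le _ hiB (v x)).trans ?_
    rw [lintegral_smul_measure, smul_eq_mul]
  refine (lintegral_mono h2).trans ?_
  rw [lintegral_smul_measure, smul_eq_mul, lintegral_const_mul' _ _ (ENNReal.inv_ne_top.2 hB),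
    ← mul_assoc, ← Measure.prod_restrict, lintegral_prod]
  exact ((hv.comp measurable_fst).sub (hv.comp measurable_snd)).enorm.pow_const 2 |>.aemeasurable

theorem ENNReal.tsum_sq_le_tsum_mul_tsum (w d : ℕ → ℝ≥0∞) (hw : ∀ k, w k ≠ 0) (hw' : ∀ k, w k ≠ ⊤) :
    (∑' k, d k) ^ 2 ≤ (∑' k, w k) * ∑' k, (w k)⁻¹ * d k ^ 2 := by
  have h := ENNReal.lintegral_mul_le_Lp_mul_Lq Measure.count Real.HolderConjugate.two_two
    (f := fun k => w k ^ (1 / 2 : ℝ)) (g := fun k => (w k)⁻¹ ^ (1 / 2 : ℝ) * d k)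
    (measurable_of_countable _).aemeasurable (measurable_of_countable _).aemeasurable
  simp only [lintegral_count, Pi.mul_apply] at h
  have e1 : ∀ k, w k ^ (1 / 2 : ℝ) * ((w k)⁻¹ ^ (1 / 2 : ℝ) * d k) = d k := by
    intro k
    rw [← mul_assoc, ← ENNReal.mul_rpow_of_nonneg _ _ (by norm_num),
      ENNReal.mul_inv_cancel (hw k) (hw' k), ENNReal.one_rpow, one_mul]
  have e2 : ∀ k, (w k ^ (1 / 2 : ℝ)) ^ (2 : ℝ) = w k := by
    intro k
    rw [← ENNReal.rpow_mul]; norm_num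
  have e3 : ∀ k, ((w k)⁻¹ ^ (1 / 2 : ℝ) * d k) ^ (2 : ℝ) = (w k)⁻¹ * d k ^ 2 := by
    intro k
    rw [ENNReal.mul_rpow_of_nonneg _ _ (by norm_num), ← ENNReal.rpow_mul]
    norm_num
  simp_rw [e1, e2, e3] at h
  have h2 := pow_le_pow_left' h 2
  rw [mul_pow, ← ENNReal.rpow_natCast, ← ENNReal.rpow_natCast (_ ^ (1 / 2 : ℝ)),
    ← ENNReal.rpow_natCast (_ ^ (1 / 2 : ℝ)), ← ENNReal.rpow_mul, ← ENNReal.rpow_mul] at h2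
  norm_num at h2
  exact h2

/-- The rectangle `(t, t + 2⁻ᵏ) × (-π, π)`. -/
def polarStrip (t : ℝ) (k : ℕ) : Set (ℝ × ℝ) :=
  Ioo t (t + (1 / 2) ^ k) ×ˢ Ioo (-Real.pi) Real.pi

/-- The image of `polarStrip t 0` under the homothety of ratio `2⁻ᵏ` centred at `(t, θ)`. These
rectangles decrease to `(t, θ)`, and the first one does not depend on `θ`. -/
def polarCell (t θ : ℝ) (k : ℕ) : Set (ℝ × ℝ) :=
  Ioo t (t + (1 / 2) ^ k) ×ˢ
    Ioo (θ - (1 / 2) ^ k * (θ + Real.pi)) (θ + (1 / 2) ^ k * (Real.pi - θ))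

theorem polarCell_zero (t θ : ℝ) : polarCell t θ 0 = polarStrip t 0 := by
  simp [polarCell, polarStrip]

theorem polarCell_subset_strip (t : ℝ) {θ : ℝ} (hθ : θ ∈ Icc (-Real.pi) Real.pi) (k : ℕ) :
    polarCell t θ k ⊆ polarStrip t k := by
  have h0 : (0 : ℝ) < (1 / 2) ^ k := by positivity
  have h1 : ((1 : ℝ) / 2) ^ k ≤ 1 := pow_le_one₀ (by norm_num) (by norm_num)
  refine prod_mono subset_rfl (Ioo_subset_Ioo ?_ ?_)
  · nlinarith [hθ.1, hθ.2]
  · nlinarith [hθ.1, hθ.2]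

theorem polarCell_succ_subset (t : ℝ) {θ : ℝ} (hθ : θ ∈ Icc (-Real.pi) Real.pi) (k : ℕ) :
    polarCell t θ (k + 1) ⊆ polarCell t θ k := by
  have h0 : (0 : ℝ) < (1 / 2) ^ k := by positivity
  have h1 : ((1 : ℝ) / 2) ^ (k + 1) = (1 / 2) ^ k / 2 := by rw [pow_succ]; ring
  unfold polarCell
  rw [h1]
  refine prod_mono (Ioo_subset_Ioo le_rfl (by linarith)) (Ioo_subset_Ioo ?_ ?_)
  · nlinarith [hθ.1, hθ.2]
  · nlinarith [hθ.1, hθ.2]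

theorem volume_polarCell (t θ : ℝ) (k : ℕ) :
    volume (polarCell t θ k) = ENNReal.ofReal (2 * Real.pi * ((1 / 2) ^ k) ^ 2) := by
  unfold polarCell
  rw [Measure.volume_eq_prod, Measure.prod_prod, Real.volume_Ioo, Real.volume_Ioo,
    ← ENNReal.ofReal_mul (by simp)]
  congr 1
  ring

theorem norm_sub_le_of_mem_polarCell {t θ : ℝ} {k : ℕ} {z w : ℝ × ℝ} (hz : z ∈ polarCell t θ k)
    (hw : w ∈ polarCell t θ k) : ‖z - w‖ ≤ 2 * Real.pi * (1 / 2) ^ k := by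
  obtain ⟨⟨h1, h2⟩, h3, h4⟩ := hz
  obtain ⟨⟨g1, g2⟩, g3, g4⟩ := hw
  have h0 : (0 : ℝ) < (1 / 2) ^ k := by positivity
  have hpi := Real.pi_gt_three
  rw [Prod.norm_def, max_le_iff, Real.norm_eq_abs, Real.norm_eq_abs, abs_le, abs_le,
    Prod.fst_sub, Prod.snd_sub]
  refine ⟨⟨?_, ?_⟩, ?_, ?_⟩ <;> nlinarith

theorem integrableOn_polarCell {v : ℝ × ℝ → ℝ} (hv : Continuous v) (t θ : ℝ) (k : ℕ) :
    IntegrableOn v (polarCell t θ k) := by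
  refine (hv.continuousOn.integrableOn_compact (isCompact_Icc.prod isCompact_Icc)).mono_set
    (prod_mono Ioo_subset_Icc_self Ioo_subset_Icc_self)

/-- The averages over the cells shrinking to `(t, θ)` converge to the value of `v` there. -/
theorem tendsto_average_polarCell {v : ℝ × ℝ → ℝ} (hv : Continuous v) (t : ℝ) {θ : ℝ}
    (hθ : θ ∈ Icc (-Real.pi) Real.pi) :
    Filter.Tendsto (fun k => ⨍ x in polarCell t θ k, v x) Filter.atTop (nhds (v (t, θ))) := by
  rw [Metric.tendsto_atTop]
  intro ε hε
  obtain ⟨δ, hδ, hcont⟩ := Metric.continuous_iff.1 hv (t, θ) (ε / 2) (by linarith)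
  obtain ⟨n, hn⟩ := exists_pow_lt_of_lt_one (y := (1 / 2 : ℝ)) (x := δ / (2 * Real.pi))
    (by positivity) (by norm_num)
  refine ⟨n, fun k hk => ?_⟩
  have hpi := Real.pi_gt_three
  have h0 : (0 : ℝ) < (1 / 2) ^ k := by positivity
  have hkn : ((1 : ℝ) / 2) ^ k < δ / (2 * Real.pi) :=
    (pow_le_pow_of_le_one (by norm_num) (by norm_num) hk).trans_lt hn
  rw [lt_div_iff₀ (by positivity)] at hkn
  have hmem : (⨍ x in polarCell t θ k, v x) ∈ Metric.closedBall (v (t, θ)) (ε / 2) := by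
    refine (convex_closedBall _ _).set_average_mem Metric.isClosed_closedBall ?_ ?_ ?_
      (integrableOn_polarCell hv t θ k)
    · rw [volume_polarCell]; simp; positivity
    · rw [volume_polarCell]; simp
    · rw [polarCell]
      filter_upwards [ae_restrict_mem (measurableSet_Ioo.prod measurableSet_Ioo)] with x hx
      refine (hcont x ?_).le
      obtain ⟨⟨h1, h2⟩, h3, h4⟩ := hx
      rw [Prod.dist_eq, max_lt_iff, Real.dist_eq, Real.dist_eq, abs_lt, abs_lt]
      refine ⟨⟨?_, ?_⟩, ?_, ?_⟩ <;> simp only <;> nlinarith [hθ.1, hθ.2]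
  exact lt_of_le_of_lt hmem (by linarith)

/-- Comparison of consecutive averages: the difference is controlled by the energy in the strip
`polarStrip t k`, whose bound does not depend on `θ`. -/
theorem edist_average_polarCell_sq_le {v : ℝ × ℝ → ℝ} (hv : Continuous v) (t : ℝ) {θ : ℝ}
    (hθ : θ ∈ Icc (-Real.pi) Real.pi) {r : ℝ} (hr : 0 ≤ r) (k : ℕ) :
    edist (⨍ x in polarCell t θ k, v x) (⨍ x in polarCell t θ (k + 1), v x) ^ 2 ≤
      ENNReal.ofReal (4 * (2 * Real.pi) ^ (r - 2) * ((1 / 2) ^ k) ^ (r - 4)) *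
        slobodeckijEnergyOn volume r (polarStrip t k) v := by
  set h : ℝ := (1 / 2) ^ k with hh
  have h0 : 0 < h := by positivity
  have hpi : 0 < 2 * Real.pi := by positivity
  have hv1 : volume (polarCell t θ k) = ENNReal.ofReal (2 * Real.pi * h ^ 2) :=
    volume_polarCell t θ k
  have hv2 : volume (polarCell t θ (k + 1)) = ENNReal.ofReal (2 * Real.pi * (h / 2) ^ 2) := by
    have : ((1 : ℝ) / 2) ^ (k + 1) = h / 2 := by rw [hh, pow_succ]; ring
    rw [volume_polarCell, this]
  have hp1 : 0 < 2 * Real.pi * h ^ 2 := by positivity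
  have hp2 : 0 < 2 * Real.pi * (h / 2) ^ 2 := by positivity
  rw [edist_eq_enorm_sub]
  refine (enorm_setAverage_sub_setAverage_sq_le (by rw [hv1]; simpa using hp1) (by rw [hv1]; simp)
    (by rw [hv2]; simpa using hp2) (by rw [hv2]; simp) hv.measurable
    (integrableOn_polarCell hv t θ k) (integrableOn_polarCell hv t θ (k + 1))).trans ?_
  have hsub : polarCell t θ k ×ˢ polarCell t θ (k + 1) ⊆ polarStrip t k ×ˢ polarStrip t k :=
    prod_mono (polarCell_subset_strip t hθ k)
      ((polarCell_succ_subset t hθ k).trans (polarCell_subset_strip t hθ k))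
  have hmeas : MeasurableSet (polarCell t θ k ×ˢ polarCell t θ (k + 1)) :=
    (measurableSet_Ioo.prod measurableSet_Ioo).prod (measurableSet_Ioo.prod measurableSet_Ioo)
  have hint : ∫⁻ p in polarCell t θ k ×ˢ polarCell t θ (k + 1), ‖v p.1 - v p.2‖ₑ ^ 2
      ∂(volume.prod volume) ≤ ENNReal.ofReal ((2 * Real.pi * h) ^ r) *
        slobodeckijEnergyOn volume r (polarStrip t k) v := by
    unfold slobodeckijEnergyOn
    rw [← lintegral_const_mul' _ _ ENNReal.ofReal_ne_top]
    refine le_trans ?_ (lintegral_mono_set hsub)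
    refine setLIntegral_mono' hmeas fun p hp => ?_
    by_cases hpp : p.1 = p.2
    · simp [hpp]
    have hle := norm_sub_le_of_mem_polarCell hp.1 (polarCell_succ_subset t hθ k hp.2)
    have hle' : ‖p.1 - p.2‖ₑ ^ r ≤ ENNReal.ofReal ((2 * Real.pi * h) ^ r) := by
      rw [← ENNReal.ofReal_rpow_of_pos (by positivity), ← ofReal_norm]
      exact ENNReal.rpow_le_rpow (ENNReal.ofReal_le_ofReal hle) hr
    have hne : ‖p.1 - p.2‖ₑ ≠ 0 := by simpa [sub_eq_zero] using hpp
    have hne0 : ‖p.1 - p.2‖ₑ ^ r ≠ 0 := by simp [hne]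
    have hnet : ‖p.1 - p.2‖ₑ ^ r ≠ ⊤ := by simp [hne]
    calc ‖v p.1 - v p.2‖ₑ ^ 2
        = ‖p.1 - p.2‖ₑ ^ r * (‖v p.1 - v p.2‖ₑ ^ 2 / ‖p.1 - p.2‖ₑ ^ r) :=
          (ENNReal.mul_div_cancel hne0 hnet).symm
      _ ≤ _ := by gcongr
  refine (mul_le_mul_right hint _).trans ?_
  rw [← mul_assoc, hv1, hv2, ← ENNReal.ofReal_inv_of_pos hp1, ← ENNReal.ofReal_inv_of_pos hp2,
    ← ENNReal.ofReal_mul (by positivity), ← ENNReal.ofReal_mul (by positivity)]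
  refine le_of_eq ?_
  congr 2
  rw [Real.rpow_sub hpi, Real.rpow_sub h0, Real.mul_rpow hpi.le h0.le]
  have e2 : (2 * Real.pi) ^ (2 : ℝ) = (2 * Real.pi) ^ 2 := by norm_cast
  have e4 : h ^ (4 : ℝ) = h ^ 4 := by norm_cast
  rw [e2, e4]
  field_simp
  ring

/-- Pointwise bound by strip energies: if `v` vanishes somewhere on `{t} × [-π, π]`, then every
value of `v` on that segment is reached by two chains of averages starting from the same cell. -/
theorem enorm_sq_le_tsum_strip {v : ℝ × ℝ → ℝ} (hv : Continuous v) (t : ℝ)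
    (hzero : ∃ θ ∈ Icc (-Real.pi) Real.pi, v (t, θ) = 0) {θ : ℝ}
    (hθ : θ ∈ Icc (-Real.pi) Real.pi) {r : ℝ} (hr : 0 ≤ r) {w : ℕ → ℝ≥0∞} (hw : ∀ k, w k ≠ 0)
    (hw' : ∀ k, w k ≠ ⊤) :
    ‖v (t, θ)‖ₑ ^ 2 ≤ 4 * ((∑' k, w k) * ∑' k, (w k)⁻¹ *
      (ENNReal.ofReal (4 * (2 * Real.pi) ^ (r - 2) * ((1 / 2) ^ k) ^ (r - 4)) *
        slobodeckijEnergyOn volume r (polarStrip t k) v)) := by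
  set e : ℕ → ℝ≥0∞ := fun k =>
    ENNReal.ofReal (4 * (2 * Real.pi) ^ (r - 2) * ((1 / 2) ^ k) ^ (r - 4)) *
        slobodeckijEnergyOn volume r (polarStrip t k) v with he
  set d : ℕ → ℝ≥0∞ := fun k => e k ^ (1 / 2 : ℝ) with hd
  have hd2 : ∀ k, d k ^ 2 = e k := by
    intro k
    rw [hd, ← ENNReal.rpow_natCast, ← ENNReal.rpow_mul]; norm_num
  have hchain : ∀ φ ∈ Icc (-Real.pi) Real.pi,
      edist (⨍ x in polarStrip t 0, v x) (v (t, φ)) ≤ ∑' k, d k := by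
    intro φ hφ
    have h1 := edist_le_tsum_of_edist_le_of_tendsto₀ (f := fun k => ⨍ x in polarCell t φ k, v x)
      d (fun k => ?_) (tendsto_average_polarCell hv t hφ)
    · simpa only [polarCell_zero] using h1
    · refine (ENNReal.pow_le_pow_left_iff two_ne_zero).1 ?_
      rw [hd2]
      exact edist_average_polarCell_sq_le hv t hφ hr k
  obtain ⟨θ₀, hθ₀, hz⟩ := hzero
  have htri : ‖v (t, θ)‖ₑ ≤ 2 * ∑' k, d k := by
    have h1 := edist_triangle_left (v (t, θ)) (v (t, θ₀)) (⨍ x in polarStrip t 0, v x)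
    rw [hz, edist_zero_right] at h1
    refine h1.trans ?_
    rw [two_mul]
    refine add_le_add (hchain θ hθ) ?_
    rw [← hz]
    exact hchain θ₀ hθ₀
  calc ‖v (t, θ)‖ₑ ^ 2 ≤ (2 * ∑' k, d k) ^ 2 := pow_le_pow_left' htri 2
    _ = 4 * (∑' k, d k) ^ 2 := by rw [mul_pow]; norm_num
    _ ≤ 4 * ((∑' k, w k) * ∑' k, (w k)⁻¹ * d k ^ 2) := by
      gcongr
      exact ENNReal.tsum_sq_le_tsum_mul_tsum w d hw hw'
    _ = _ := by simp only [hd2, he]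

theorem measurable_slobodeckij {E : Type*} [NormedAddCommGroup E] [MeasurableSpace E]
    [BorelSpace E] [SecondCountableTopology E] {v : E → ℝ} (hv : Measurable v) (r : ℝ) :
    Measurable fun p : E × E => ‖v p.1 - v p.2‖ₑ ^ 2 / ‖p.1 - p.2‖ₑ ^ r :=
  (((hv.comp measurable_fst).sub (hv.comp measurable_snd)).enorm.pow_const 2).div
    ((measurable_fst.sub measurable_snd).enorm.pow_const r)

theorem measurableSet_strip_pairs (k : ℕ) :
    MeasurableSet {q : ℝ × ((ℝ × ℝ) × (ℝ × ℝ)) | q.2 ∈ polarStrip q.1 k ×ˢ polarStrip q.1 k} := by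
  have lt : ∀ f g : ℝ × ((ℝ × ℝ) × (ℝ × ℝ)) → ℝ, Continuous f → Continuous g →
      IsOpen {q | f q < g q} := fun f g hf hg => isOpen_lt hf hg
  simp only [polarStrip, mem_prod, mem_Ioo]
  refine IsOpen.measurableSet (IsOpen.and (IsOpen.and (IsOpen.and ?_ ?_) (IsOpen.and ?_ ?_))
    (IsOpen.and (IsOpen.and ?_ ?_) (IsOpen.and ?_ ?_))) <;>
  · refine lt _ _ ?_ ?_ <;> fun_prop

/-- The energy density of a pair of points that both lie in the strip over `t`. -/
def stripKernel (v : ℝ × ℝ → ℝ) (r : ℝ) (k : ℕ) (t : ℝ) (p : (ℝ × ℝ) × (ℝ × ℝ)) : ℝ≥0∞ :=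
  {q : ℝ × ((ℝ × ℝ) × (ℝ × ℝ)) | q.2 ∈ polarStrip q.1 k ×ˢ polarStrip q.1 k}.indicator
    (fun q => ‖v q.2.1 - v q.2.2‖ₑ ^ 2 / ‖q.2.1 - q.2.2‖ₑ ^ r) (t, p)

theorem measurable_stripKernel {v : ℝ × ℝ → ℝ} (hv : Measurable v) (r : ℝ) (k : ℕ) :
    Measurable (Function.uncurry (stripKernel v r k)) :=
  ((measurable_slobodeckij hv r).comp measurable_snd).indicator (measurableSet_strip_pairs k)

theorem slobodeckijEnergyOn_strip_eq (v : ℝ × ℝ → ℝ) (r t : ℝ) (k : ℕ) :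
    slobodeckijEnergyOn volume r (polarStrip t k) v =
      ∫⁻ p, stripKernel v r k t p ∂(volume.prod volume) := by
  unfold slobodeckijEnergyOn
  rw [← lintegral_indicator]
  · rfl
  · exact (measurableSet_Ioo.prod measurableSet_Ioo).prod
      (measurableSet_Ioo.prod measurableSet_Ioo)

theorem measurable_slobodeckijEnergyOn_strip {v : ℝ × ℝ → ℝ} (hv : Measurable v) (r : ℝ) (k : ℕ) :
    Measurable fun t => slobodeckijEnergyOn volume r (polarStrip t k) v := by
  simp_rw [slobodeckijEnergyOn_strip_eq]
  exact (measurable_stripKernel hv r k).lintegral_prod_right'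

/-- Averaging the strip energies over `t` gains the width `2⁻ᵏ` of the strip. -/
theorem lintegral_slobodeckijEnergyOn_strip_le {v : ℝ × ℝ → ℝ} (hv : Measurable v) (r a b : ℝ)
    (k : ℕ) :
    ∫⁻ t in Ioo a b, slobodeckijEnergyOn volume r (polarStrip t k) v ≤
      ENNReal.ofReal ((1 / 2) ^ k) *
        slobodeckijEnergyOn volume r (Ioo a (b + 1) ×ˢ Ioo (-Real.pi) Real.pi) v := by
  have hk1 : ((1 : ℝ) / 2) ^ k ≤ 1 := pow_le_one₀ (by norm_num) (by norm_num)
  simp_rw [slobodeckijEnergyOn_strip_eq]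
  rw [lintegral_lintegral_swap (measurable_stripKernel hv r k).aemeasurable]
  unfold slobodeckijEnergyOn
  rw [← lintegral_const_mul' _ _ ENNReal.ofReal_ne_top, ← lintegral_indicator
    ((measurableSet_Ioo.prod measurableSet_Ioo).prod (measurableSet_Ioo.prod measurableSet_Ioo))]
  refine lintegral_mono fun p => ?_
  have hb : ∀ t ∈ Ioo a b, stripKernel v r k t p ≤
      (Ioo (p.1.1 - (1 / 2) ^ k) p.1.1).indicator (fun _ =>
        ((Ioo a (b + 1) ×ˢ Ioo (-Real.pi) Real.pi) ×ˢ
          (Ioo a (b + 1) ×ˢ Ioo (-Real.pi) Real.pi)).indicator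
        (fun p : (ℝ × ℝ) × (ℝ × ℝ) => ‖v p.1 - v p.2‖ₑ ^ 2 / ‖p.1 - p.2‖ₑ ^ r) p) t := by
    intro t ht
    unfold stripKernel
    by_cases hmem : p ∈ polarStrip t k ×ˢ polarStrip t k
    · obtain ⟨⟨⟨h1, h2⟩, h3⟩, ⟨⟨h4, h5⟩, h6⟩⟩ := id hmem
      have m1 : t ∈ Ioo (p.1.1 - (1 / 2) ^ k) p.1.1 := ⟨by linarith, h1⟩
      have m2 : p ∈ (Ioo a (b + 1) ×ˢ Ioo (-Real.pi) Real.pi) ×ˢ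
          (Ioo a (b + 1) ×ˢ Ioo (-Real.pi) Real.pi) :=
        ⟨⟨⟨by linarith [ht.1], by linarith [ht.2]⟩, h3⟩,
          ⟨⟨by linarith [ht.1], by linarith [ht.2]⟩, h6⟩⟩
      rw [indicator_of_mem m1, indicator_of_mem m2]
      exact indicator_le_self _ _ _
    · rw [indicator_of_notMem (by exact hmem)]
      exact zero_le
  refine (setLIntegral_mono' measurableSet_Ioo hb).trans ?_
  refine (setLIntegral_le_lintegral _ _).trans ?_
  rw [lintegral_indicator_const measurableSet_Ioo, Real.volume_Ioo, sub_sub_cancel, mul_comm]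
  by_cases hm : p ∈ (Ioo a (b + 1) ×ˢ Ioo (-Real.pi) Real.pi) ×ˢ
          (Ioo a (b + 1) ×ˢ Ioo (-Real.pi) Real.pi)
  · rw [indicator_of_mem hm, indicator_of_mem hm]
  · rw [indicator_of_notMem hm, indicator_of_notMem hm, mul_zero]

/-- Fractional Poincaré inequality on a rectangle for functions having a zero on each segment
`{t} × [-π, π]`. The exponent `s > 1 / 2` makes the geometric series over the scales converge. -/
theorem exists_rectangle_poincare {s : ℝ} (hs : 1 / 2 < s) : ∃ C : ℝ≥0∞, C ≠ ⊤ ∧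
    ∀ (v : ℝ × ℝ → ℝ) (a b : ℝ), Continuous v →
      (∀ t ∈ Ioo a b, ∃ θ ∈ Icc (-Real.pi) Real.pi, v (t, θ) = 0) →
      ∫⁻ x in Ioo a b ×ˢ Ioo (-Real.pi) Real.pi, ‖v x‖ₑ ^ 2 ≤
        C * slobodeckijEnergyOn volume (2 + 2 * s)
          (Ioo a (b + 1) ×ˢ Ioo (-Real.pi) Real.pi) v := by
  -- The weights `2^(-k(s-1/2))` split the exponent evenly: both factors of the Cauchy–Schwarz bound
  -- become the same geometric series.
  set w : ℕ → ℝ≥0∞ := fun k => ENNReal.ofReal (((1 / 2) ^ k) ^ (s - 1 / 2)) with hw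
  have hwpos : ∀ k : ℕ, 0 < (((1 : ℝ) / 2) ^ k) ^ (s - 1 / 2) := fun k => by positivity
  have hw0 : ∀ k, w k ≠ 0 := fun k => by simpa [hw] using hwpos k
  have hwt : ∀ k, w k ≠ ⊤ := fun k => ENNReal.ofReal_ne_top
  set A := ∑' k, w k with hA
  have hAt : A ≠ ⊤ := by
    have hlt : (1 / 2 : ℝ) ^ (s - 1 / 2) < 1 :=
      Real.rpow_lt_one (by norm_num) (by norm_num) (by linarith)
    have : w = fun k => ENNReal.ofReal (((1 / 2 : ℝ) ^ (s - 1 / 2)) ^ k) := by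
      funext k
      simp only [hw]
      rw [← Real.rpow_natCast, ← Real.rpow_natCast, ← Real.rpow_mul (by norm_num),
        ← Real.rpow_mul (by norm_num), mul_comm]
    rw [hA, this]
    exact (summable_geometric_of_lt_one (by positivity) hlt).tsum_ofReal_ne_top
  set c : ℝ := 4 * (2 * Real.pi) ^ (2 * s) with hc
  refine ⟨ENNReal.ofReal (2 * Real.pi) * (4 * (A * (ENNReal.ofReal c * A))), ?_, ?_⟩
  · exact ENNReal.mul_ne_top ENNReal.ofReal_ne_top (ENNReal.mul_ne_top (by norm_num)
      (ENNReal.mul_ne_top hAt (ENNReal.mul_ne_top ENNReal.ofReal_ne_top hAt)))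
  intro v a b hv hzero
  set r := 2 + 2 * s with hr
  set T := slobodeckijEnergyOn volume r (Ioo a (b + 1) ×ˢ Ioo (-Real.pi) Real.pi) v
  set g : ℝ → ℝ≥0∞ := fun t => 4 * (A * ∑' k, (w k)⁻¹ *
      (ENNReal.ofReal (4 * (2 * Real.pi) ^ (r - 2) * ((1 / 2) ^ k) ^ (r - 4)) *
        slobodeckijEnergyOn volume r (polarStrip t k) v)) with hg
  have hpt : ∀ x ∈ Ioo a b ×ˢ Ioo (-Real.pi) Real.pi, ‖v x‖ₑ ^ 2 ≤ g x.1 := fun x hx =>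
    enorm_sq_le_tsum_strip hv x.1 (hzero _ hx.1) (Ioo_subset_Icc_self hx.2) (by linarith) hw0 hwt
  have hgm : Measurable g := by
    refine Measurable.const_mul (Measurable.const_mul (Measurable.tsum fun k => ?_) _) _
    exact ((measurable_slobodeckijEnergyOn_strip hv.measurable r k).const_mul _).const_mul _
  have hcoef : ∀ k, (w k)⁻¹ *
      (ENNReal.ofReal (4 * (2 * Real.pi) ^ (r - 2) * ((1 / 2) ^ k) ^ (r - 4)) *
        (ENNReal.ofReal ((1 / 2) ^ k) * T)) = w k * (ENNReal.ofReal c * T) := by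
    intro k
    have h0 : (0 : ℝ) < (1 / 2) ^ k := by positivity
    simp only [hw]
    rw [← ENNReal.ofReal_inv_of_pos (hwpos k), ← mul_assoc, ← mul_assoc, ← mul_assoc,
      ← ENNReal.ofReal_mul (by positivity), ← ENNReal.ofReal_mul (by positivity),
      ← ENNReal.ofReal_mul (by positivity)]
    congr 2
    have e1 : r - 2 = 2 * s := by rw [hr]; ring
    rw [e1, ← Real.rpow_neg h0.le, hc]
    calc (((1 : ℝ) / 2) ^ k) ^ (-(s - 1 / 2)) *
          (4 * (2 * Real.pi) ^ (2 * s) * ((1 / 2) ^ k) ^ (r - 4)) * (1 / 2) ^ k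
        = 4 * (2 * Real.pi) ^ (2 * s) * ((((1 : ℝ) / 2) ^ k) ^ (-(s - 1 / 2)) *
          ((1 / 2) ^ k) ^ (r - 4) * (((1 : ℝ) / 2) ^ k) ^ (1 : ℝ)) := by
          rw [Real.rpow_one]; ring
      _ = 4 * (2 * Real.pi) ^ (2 * s) * (((1 : ℝ) / 2) ^ k) ^ (s - 1 / 2) := by
          rw [← Real.rpow_add h0, ← Real.rpow_add h0]
          congr 2
          rw [hr]; ring
      _ = _ := by ring
  calc ∫⁻ x in Ioo a b ×ˢ Ioo (-Real.pi) Real.pi, ‖v x‖ₑ ^ 2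
      ≤ ∫⁻ x in Ioo a b ×ˢ Ioo (-Real.pi) Real.pi, g x.1 :=
        setLIntegral_mono' (measurableSet_Ioo.prod measurableSet_Ioo) hpt
    _ = ENNReal.ofReal (2 * Real.pi) * ∫⁻ t in Ioo a b, g t := by
        rw [Measure.volume_eq_prod, ← Measure.prod_restrict,
          lintegral_prod (fun x : ℝ × ℝ => g x.1) (hgm.comp measurable_fst).aemeasurable]
        simp only [lintegral_const, Measure.restrict_apply_univ, Real.volume_Ioo]
        rw [lintegral_mul_const _ hgm, mul_comm]
        congr 2
        ring
    _ ≤ ENNReal.ofReal (2 * Real.pi) * (4 * (A * ∑' k, w k * (ENNReal.ofReal c * T))) := by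
        gcongr
        rw [hg, lintegral_const_mul' _ _ (by norm_num), lintegral_const_mul' _ _ hAt,
          lintegral_tsum fun k => (((measurable_slobodeckijEnergyOn_strip
            hv.measurable r k).const_mul _).const_mul _).aemeasurable]
        gcongr with k
        rw [← hcoef k, lintegral_const_mul' _ _ (ENNReal.inv_ne_top.2 (hw0 k)),
          lintegral_const_mul' _ _ ENNReal.ofReal_ne_top]
        gcongr
        exact lintegral_slobodeckijEnergyOn_strip_le hv.measurable r a b k
    _ = _ := by rw [ENNReal.tsum_mul_right]; ring

/-! ### Polar coordinates and the global Poincaré inequality -/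

theorem measurePreserving_toPlane : MeasurePreserving toPlane (volume : Measure (ℝ × ℝ)) volume :=
  (PiLp.volume_preserving_toLp (Fin 2)).comp (volume_preserving_finTwoArrow ℝ).symm

theorem ENNReal.div_le_mul_div_of_le {a x y c : ℝ≥0∞} (hc : c ≠ 0) (hc' : c ≠ ⊤)
    (h : y ≤ c * x) : a / x ≤ c * (a / y) := by
  rw [← ENNReal.mul_div_mul_left a x hc hc', ← mul_div_assoc]
  exact ENNReal.div_le_div_left h _

theorem continuous_toPlane : Continuous toPlane := by
  unfold toPlane
  fun_prop

theorem measurableEmbedding_toPlane : MeasurableEmbedding toPlane :=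
  (MeasurableEquiv.toLp 2 (Fin 2 → ℝ)).measurableEmbedding.comp
    (MeasurableEquiv.finTwoArrow (α := ℝ)).symm.measurableEmbedding

theorem norm_toPlane (q : ℝ × ℝ) : ‖toPlane q‖ = √(q.1 ^ 2 + q.2 ^ 2) := by
  rw [EuclideanSpace.norm_eq]
  simp

theorem toPlane_sub (q r : ℝ × ℝ) : toPlane (q - r) = toPlane q - toPlane r := by
  ext i; fin_cases i <;> rfl

/-- The polar parametrisation of the plane, centred at `p`. -/
def polarMap (p : Plane) (z : ℝ × ℝ) : Plane :=
  p + toPlane (z.1 * Real.cos z.2, z.1 * Real.sin z.2)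

theorem continuous_polarMap (p : Plane) : Continuous (polarMap p) :=
  continuous_const.add (continuous_toPlane.comp (by fun_prop))

/-- The open annulus `{x | a < |x - p| < b}`. -/
def annulus (p : Plane) (a b : ℝ) : Set Plane := {x | a < ‖x - p‖ ∧ ‖x - p‖ < b}

theorem measurableSet_annulus (p : Plane) (a b : ℝ) : MeasurableSet (annulus p a b) :=
  IsOpen.measurableSet (IsOpen.and (isOpen_lt (by fun_prop) (by fun_prop))
    (isOpen_lt (by fun_prop) (by fun_prop)))

theorem norm_polarMap_sub {p : Plane} {z : ℝ × ℝ} (hz : 0 ≤ z.1) : ‖polarMap p z - p‖ = z.1 := by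
  rw [polarMap, add_sub_cancel_left, norm_toPlane]
  simp only [mul_pow]
  rw [← mul_add, Real.cos_sq_add_sin_sq, mul_one, Real.sqrt_sq hz]

theorem lintegral_polarMap (p : Plane) (f : Plane → ℝ≥0∞) :
    ∫⁻ z in Ioi (0 : ℝ) ×ˢ Ioo (-Real.pi) Real.pi, ENNReal.ofReal z.1 * f (polarMap p z) =
      ∫⁻ x, f x := by
  rw [← lintegral_add_left_eq_self f p,
    ← measurePreserving_toPlane.lintegral_comp_emb measurableEmbedding_toPlane,
    ← lintegral_comp_polarCoord_symm]
  rfl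

theorem setLIntegral_polarMap_le (p : Plane) {a b : ℝ} (ha : 0 < a) (f : Plane → ℝ≥0∞) :
    ∫⁻ z in Ioo a b ×ˢ Ioo (-Real.pi) Real.pi, f (polarMap p z) ≤
      ENNReal.ofReal a⁻¹ * ∫⁻ x in annulus p a b, f x := by
  rw [← lintegral_indicator (measurableSet_annulus p a b), ← lintegral_polarMap p,
    ← lintegral_const_mul' _ _ ENNReal.ofReal_ne_top]
  refine le_trans ?_ (lintegral_mono_set
    (prod_mono (fun x hx => ha.trans hx.1) subset_rfl : Ioo a b ×ˢ Ioo (-Real.pi) Real.pi ⊆ _))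
  refine setLIntegral_mono' (measurableSet_Ioo.prod measurableSet_Ioo) fun z hz => ?_
  have hz0 : 0 < z.1 := ha.trans hz.1.1
  have hmem : polarMap p z ∈ annulus p a b := by
    rw [annulus, mem_ofPred_eq, norm_polarMap_sub hz0.le]
    exact hz.1
  rw [indicator_of_mem hmem, ← mul_assoc, ← ENNReal.ofReal_mul (by positivity)]
  refine le_mul_of_one_le_left zero_le ?_
  rw [ENNReal.one_le_ofReal, ← div_eq_inv_mul, one_le_div ha]
  exact hz.1.1.le

theorem setLIntegral_annulus_le (p : Plane) (a b : ℝ) (f : Plane → ℝ≥0∞) :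
    ∫⁻ x in annulus p a b, f x ≤
      ENNReal.ofReal b * ∫⁻ z in Ioo a b ×ˢ Ioo (-Real.pi) Real.pi, f (polarMap p z) := by
  rw [← lintegral_indicator (measurableSet_annulus p a b), ← lintegral_polarMap p,
    ← lintegral_const_mul' _ _ ENNReal.ofReal_ne_top,
    ← lintegral_indicator (measurableSet_Ioo.prod measurableSet_Ioo),
    ← lintegral_indicator (measurableSet_Ioi.prod measurableSet_Ioo)]
  refine lintegral_mono fun z => ?_
  by_cases hz : z ∈ Ioi (0 : ℝ) ×ˢ Ioo (-Real.pi) Real.pi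
  · rw [indicator_of_mem hz]
    by_cases hA : polarMap p z ∈ annulus p a b
    · have hA' := hA
      rw [annulus, mem_ofPred_eq, norm_polarMap_sub (le_of_lt hz.1)] at hA'
      have hz' : z ∈ Ioo a b ×ˢ Ioo (-Real.pi) Real.pi := ⟨hA', hz.2⟩
      rw [indicator_of_mem hA, indicator_of_mem hz']
      gcongr
      exact hA'.2.le
    · rw [indicator_of_notMem hA, mul_zero]
      exact zero_le
  · rw [indicator_of_notMem hz]
    exact zero_le

theorem norm_polarMap_sub_polarMap_le (p : Plane) {z w : ℝ × ℝ} {b : ℝ}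
    (hw : 0 ≤ w.1) (hwb : w.1 ≤ b) :
    ‖polarMap p z - polarMap p w‖ ≤ 2 * (1 + b) * ‖z - w‖ := by
  have h1 : |z.1 - w.1| ≤ ‖z - w‖ := norm_fst_le (z - w)
  have h2 : |z.2 - w.2| ≤ ‖z - w‖ := norm_snd_le (z - w)
  have hb : 0 ≤ b := hw.trans hwb
  set m := ‖z - w‖ with hm
  have hm0 : 0 ≤ m := norm_nonneg _
  have hc : |Real.cos z.2 - Real.cos w.2| ≤ m := (Real.abs_cos_sub_cos_le _ _).trans h2
  have hs : |Real.sin z.2 - Real.sin w.2| ≤ m := (Real.abs_sin_sub_sin_le _ _).trans h2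
  have key : ∀ x y : ℝ, |x| ≤ 1 → |x - y| ≤ m → |z.1 * x - w.1 * y| ≤ (1 + b) * m := by
    intro x y hx hxy
    calc |z.1 * x - w.1 * y| = |(z.1 - w.1) * x + w.1 * (x - y)| := by ring_nf
      _ ≤ |(z.1 - w.1) * x| + |w.1 * (x - y)| := abs_add_le _ _
      _ = |z.1 - w.1| * |x| + w.1 * |x - y| := by rw [abs_mul, abs_mul, abs_of_nonneg hw]
      _ ≤ m * 1 + b * m := by gcongr
      _ = (1 + b) * m := by ring
  have e1 := key _ _ (Real.abs_cos_le_one z.2) hc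
  have e2 := key _ _ (Real.abs_sin_le_one z.2) hs
  have hsub : polarMap p z - polarMap p w =
      toPlane (z.1 * Real.cos z.2 - w.1 * Real.cos w.2,
        z.1 * Real.sin z.2 - w.1 * Real.sin w.2) := by
    rw [polarMap, polarMap, add_sub_add_left_eq_sub, ← toPlane_sub]
    rfl
  rw [hsub, norm_toPlane]
  refine Real.sqrt_le_iff.2 ⟨by positivity, ?_⟩
  have f1 := sq_le_sq' (abs_le.1 e1).1 (abs_le.1 e1).2
  have f2 := sq_le_sq' (abs_le.1 e2).1 (abs_le.1 e2).2
  nlinarith [mul_nonneg (by linarith : 0 ≤ 1 + b) hm0]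

theorem slobodeckij_polarMap_le (p : Plane) {b r : ℝ} (hr : 0 ≤ r) (u : Plane → ℝ)
    {z w : ℝ × ℝ} (hw : 0 ≤ w.1) (hwb : w.1 ≤ b) :
    ‖u (polarMap p z) - u (polarMap p w)‖ₑ ^ 2 / ‖z - w‖ₑ ^ r ≤
      ENNReal.ofReal (2 * (1 + b)) ^ r *
        (‖u (polarMap p z) - u (polarMap p w)‖ₑ ^ 2 / ‖polarMap p z - polarMap p w‖ₑ ^ r) := by
  have hb : 0 ≤ b := hw.trans hwb
  have hL0 : 0 < ENNReal.ofReal (2 * (1 + b)) := by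
    rw [ENNReal.ofReal_pos]; positivity
  refine ENNReal.div_le_mul_div_of_le (ENNReal.rpow_pos hL0 ENNReal.ofReal_ne_top).ne'
    (ENNReal.rpow_ne_top_of_nonneg hr ENNReal.ofReal_ne_top) ?_
  rw [← ENNReal.mul_rpow_of_nonneg _ _ hr]
  refine ENNReal.rpow_le_rpow ?_ hr
  rw [← ofReal_norm, ← ofReal_norm, ← ENNReal.ofReal_mul (by positivity)]
  exact ENNReal.ofReal_le_ofReal (norm_polarMap_sub_polarMap_le p hw hwb)

/-- Passing from polar coordinates to the annulus only costs a constant, because the polar map is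
Lipschitz on a bounded rectangle and its Jacobian is bounded below there. -/
theorem slobodeckijEnergyOn_polarMap_le (p : Plane) {a b r : ℝ} (ha : 0 < a)
    (hr : 0 ≤ r) {u : Plane → ℝ} (hu : Continuous u) :
    slobodeckijEnergyOn volume r (Ioo a b ×ˢ Ioo (-Real.pi) Real.pi) (fun z => u (polarMap p z)) ≤
      ENNReal.ofReal (2 * (1 + b)) ^ r * (ENNReal.ofReal a⁻¹ * (ENNReal.ofReal a⁻¹ *
        slobodeckijEnergyOn volume r (annulus p a b) u)) := by
  have hLrt : ENNReal.ofReal (2 * (1 + b)) ^ r ≠ ⊤ :=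
    ENNReal.rpow_ne_top_of_nonneg hr ENNReal.ofReal_ne_top
  have hBm : MeasurableSet (Ioo a b ×ˢ Ioo (-Real.pi) Real.pi) :=
    measurableSet_Ioo.prod measurableSet_Ioo
  have hGm : Measurable (fun q : Plane × Plane => ‖u q.1 - u q.2‖ₑ ^ 2 / ‖q.1 - q.2‖ₑ ^ r) :=
    measurable_slobodeckij hu.measurable r
  obtain ⟨G, hG⟩ : ∃ G : Plane → Plane → ℝ≥0∞,
    ∀ x y, G x y = ‖u x - u y‖ₑ ^ 2 / ‖x - y‖ₑ ^ r := ⟨_, fun _ _ => rfl⟩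
  simp_rw [← hG] at hGm
  have hpm := (continuous_polarMap p).measurable
  have hGm' : Measurable (fun q : (ℝ × ℝ) × (ℝ × ℝ) => G (polarMap p q.1) (polarMap p q.2)) :=
    hGm.comp ((hpm.comp measurable_fst).prodMk (hpm.comp measurable_snd))
  unfold slobodeckijEnergyOn
  simp_rw [← hG]
  rw [← Measure.prod_restrict (annulus p a b) (annulus p a b), lintegral_prod _ hGm.aemeasurable,
    ← lintegral_const_mul' _ _ ENNReal.ofReal_ne_top]
  have h1 : ∫⁻ q in (Ioo a b ×ˢ Ioo (-Real.pi) Real.pi) ×ˢ (Ioo a b ×ˢ Ioo (-Real.pi) Real.pi),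
      ‖u (polarMap p q.1) - u (polarMap p q.2)‖ₑ ^ 2 / ‖q.1 - q.2‖ₑ ^ r ∂(volume.prod volume) ≤
      ∫⁻ q in (Ioo a b ×ˢ Ioo (-Real.pi) Real.pi) ×ˢ (Ioo a b ×ˢ Ioo (-Real.pi) Real.pi),
      ENNReal.ofReal (2 * (1 + b)) ^ r * G (polarMap p q.1) (polarMap p q.2)
        ∂(volume.prod volume) := by
    refine setLIntegral_mono' (hBm.prod hBm) fun q hq => ?_
    rw [hG]
    exact slobodeckij_polarMap_le p hr u (ha.trans hq.2.1.1).le hq.2.1.2.le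
  refine h1.trans ?_
  rw [lintegral_const_mul' _ _ hLrt, ← Measure.prod_restrict, lintegral_prod _ hGm'.aemeasurable]
  refine mul_le_mul_right ?_ _
  refine (lintegral_mono fun z => setLIntegral_polarMap_le p ha (G (polarMap p z))).trans ?_
  exact setLIntegral_polarMap_le p ha
    (fun x => ENNReal.ofReal a⁻¹ * ∫⁻ y in annulus p a b, G x y)

theorem exists_annulus_poincare {s : ℝ} (hs : 1 / 2 < s) {a : ℝ} (b : ℝ) (ha : 0 < a) :
    ∃ C : ℝ≥0∞, C ≠ ⊤ ∧ ∀ (u : Plane → ℝ) (p : Plane), Continuous u →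
      (∀ t ∈ Ioo a b, ∃ θ ∈ Icc (-Real.pi) Real.pi, u (polarMap p (t, θ)) = 0) →
      ∫⁻ x in annulus p a b, ‖u x‖ₑ ^ 2 ≤
        C * slobodeckijEnergyOn volume (2 + 2 * s) (annulus p a (b + 1)) u := by
  obtain ⟨C, hC, h⟩ := exists_rectangle_poincare hs
  refine ⟨ENNReal.ofReal b * (C * (ENNReal.ofReal (2 * (1 + (b + 1))) ^ (2 + 2 * s) *
    (ENNReal.ofReal a⁻¹ * ENNReal.ofReal a⁻¹))), ?_, ?_⟩
  · refine ENNReal.mul_ne_top ENNReal.ofReal_ne_top (ENNReal.mul_ne_top hC (ENNReal.mul_ne_top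
      (ENNReal.rpow_ne_top_of_nonneg (by linarith) ENNReal.ofReal_ne_top)
      (ENNReal.mul_ne_top ENNReal.ofReal_ne_top ENNReal.ofReal_ne_top)))
  intro u p hu hz
  refine (setLIntegral_annulus_le p a b _).trans ?_
  rw [mul_assoc, mul_assoc]
  gcongr
  refine (h (fun z => u (polarMap p z)) a b (hu.comp (continuous_polarMap p)) hz).trans ?_
  gcongr
  refine (slobodeckijEnergyOn_polarMap_le p ha (by linarith) hu).trans (le_of_eq ?_)
  ring

/-- Local estimates on all balls of fixed radii integrate to a global one, by integrating over the
centre. -/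
theorem lintegral_le_of_forall_ball {r R D : ℝ} {C : ℝ≥0∞} (hC : C ≠ ⊤)
    {u : Plane → ℝ} (hu : Continuous u)
    (h : ∀ c, ∫⁻ x in Metric.ball c R, ‖u x‖ₑ ^ 2 ≤
      C * slobodeckijEnergyOn volume r (Metric.ball c D) u) :
    volume (Metric.ball (0 : Plane) R) * ∫⁻ x, ‖u x‖ₑ ^ 2 ≤
      C * volume (Metric.ball (0 : Plane) D) * slobodeckijEnergy volume r u := by
  have hum : Measurable fun x => ‖u x‖ₑ ^ 2 := hu.measurable.enorm.pow_const 2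
  have hGm := measurable_slobodeckij hu.measurable r
  have hleft : ∫⁻ c, ∫⁻ x in Metric.ball c R, ‖u x‖ₑ ^ 2 =
      volume (Metric.ball (0 : Plane) R) * ∫⁻ x, ‖u x‖ₑ ^ 2 := by
    have hset : MeasurableSet {q : Plane × Plane | dist q.2 q.1 < R} :=
      (isOpen_lt (by fun_prop) continuous_const).measurableSet
    have e1 : ∀ c, ∫⁻ x in Metric.ball c R, ‖u x‖ₑ ^ 2 =
        ∫⁻ x, {q : Plane × Plane | dist q.2 q.1 < R}.indicator (fun q => ‖u q.2‖ₑ ^ 2) (c, x) := by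
      intro c
      rw [← lintegral_indicator measurableSet_ball]
      rfl
    simp_rw [e1]
    rw [lintegral_lintegral_swap
      (f := fun c x => {q : Plane × Plane | dist q.2 q.1 < R}.indicator
        (fun q => ‖u q.2‖ₑ ^ 2) (c, x))
      ((hum.comp measurable_snd).indicator hset).aemeasurable,
      ← lintegral_const_mul _ hum]
    refine lintegral_congr fun x => ?_
    have e2 : ∀ c, {q : Plane × Plane | dist q.2 q.1 < R}.indicator
        (fun q => ‖u q.2‖ₑ ^ 2) (c, x) =
        (Metric.ball x R).indicator (fun _ => ‖u x‖ₑ ^ 2) c := by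
      intro c
      simp only [indicator, mem_ofPred_eq, Metric.mem_ball, dist_comm x c]
    simp_rw [e2]
    rw [lintegral_indicator_const measurableSet_ball, Measure.addHaar_ball_center, mul_comm]
  have hright : ∫⁻ c, slobodeckijEnergyOn volume r (Metric.ball c D) u ≤
      volume (Metric.ball (0 : Plane) D) * slobodeckijEnergy volume r u := by
    have hset : MeasurableSet {q : Plane × (Plane × Plane) |
        dist q.2.1 q.1 < D ∧ dist q.2.2 q.1 < D} :=
      IsOpen.measurableSet (IsOpen.and (isOpen_lt (by fun_prop) (by fun_prop))
        (isOpen_lt (by fun_prop) (by fun_prop)))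
    have e1 : ∀ c, slobodeckijEnergyOn volume r (Metric.ball c D) u =
        ∫⁻ p, {q : Plane × (Plane × Plane) | dist q.2.1 q.1 < D ∧ dist q.2.2 q.1 < D}.indicator
          (fun q => ‖u q.2.1 - u q.2.2‖ₑ ^ 2 / ‖q.2.1 - q.2.2‖ₑ ^ r) (c, p)
          ∂(volume.prod volume) := by
      intro c
      unfold slobodeckijEnergyOn
      rw [← lintegral_indicator (measurableSet_ball.prod measurableSet_ball)]
      rfl
    simp_rw [e1]
    rw [lintegral_lintegral_swap
      (f := fun c p => {q : Plane × (Plane × Plane) |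
          dist q.2.1 q.1 < D ∧ dist q.2.2 q.1 < D}.indicator
        (fun q => ‖u q.2.1 - u q.2.2‖ₑ ^ 2 / ‖q.2.1 - q.2.2‖ₑ ^ r) (c, p))
      ((hGm.comp measurable_snd).indicator hset).aemeasurable]
    unfold slobodeckijEnergy
    rw [← lintegral_const_mul _ hGm]
    refine lintegral_mono fun p => ?_
    refine le_trans (lintegral_mono (g := fun c => (Metric.ball p.1 D).indicator
      (fun _ => ‖u p.1 - u p.2‖ₑ ^ 2 / ‖p.1 - p.2‖ₑ ^ r) c) fun c => ?_) ?_
    · simp only [indicator, mem_ofPred_eq, Metric.mem_ball, dist_comm c p.1]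
      split_ifs with h1 h2
      · exact le_rfl
      · exact absurd h1.1 h2
      · exact zero_le
      · exact le_rfl
    · rw [lintegral_indicator_const measurableSet_ball, Measure.addHaar_ball_center, mul_comm]
  rw [← hleft, mul_assoc]
  calc _ ≤ ∫⁻ c, C * slobodeckijEnergyOn volume r (Metric.ball c D) u := lintegral_mono h
    _ = C * ∫⁻ c, slobodeckijEnergyOn volume r (Metric.ball c D) u := lintegral_const_mul' _ _ hC
    _ ≤ _ := by gcongr

/-- Fractional Poincaré inequality for test functions on a simply connected set whose complement
meets every ball of radius `R`. -/
theorem exists_poincare_of_isSimplyConnected {s : ℝ} (hs : 1 / 2 < s) {R : ℝ} (hR : 0 < R)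
    {Ω : Set Plane} (hΩ : IsOpen Ω) (hsc : IsSimplyConnected Ω)
    (hball : ∀ c : Plane, ∃ p ∉ Ω, dist p c < R) :
    ∃ K : ℝ≥0∞, K ≠ ⊤ ∧ ∀ u, IsTestFunctionOn Ω u →
      ∫⁻ x, ‖u x‖ₑ ^ 2 ≤ K * slobodeckijEnergy volume (2 + 2 * s) u := by
  obtain ⟨C, hC, h⟩ := exists_annulus_poincare hs (a := 2 * R) (6 * R)
    (by linarith)
  set D := 11 * R + 1
  set VR := volume (Metric.ball (0 : Plane) R)
  set VD := volume (Metric.ball (0 : Plane) D)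
  have hVR0 : VR ≠ 0 := (Metric.measure_ball_pos _ _ hR).ne'
  have hVRt : VR ≠ ⊤ := measure_ball_lt_top.ne
  have hVDt : VD ≠ ⊤ := measure_ball_lt_top.ne
  refine ⟨VR⁻¹ * (C * VD), ENNReal.mul_ne_top (ENNReal.inv_ne_top.2 hVR0)
    (ENNReal.mul_ne_top hC hVDt), fun u hu => ?_⟩
  have hlocal : ∀ c, ∫⁻ x in Metric.ball c R, ‖u x‖ₑ ^ 2 ≤
      C * slobodeckijEnergyOn volume (2 + 2 * s) (Metric.ball c D) u := by
    intro c
    set e : Plane := toPlane (4 * R, 0) with he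
    have hen : ‖e‖ = 4 * R := by
      rw [he, norm_toPlane]
      simp only [ne_eq, OfNat.ofNat_ne_zero, not_false_eq_true, zero_pow, add_zero]
      exact Real.sqrt_sq (by linarith)
    -- The centre `p` of the circles lies outside `Ω`, near a point at distance `4 R` from `c`, so
    -- that the ball around `c` stays away from the singular point of the polar coordinates.
    obtain ⟨p, hp, hpc⟩ := hball (c + e)
    rw [dist_eq_norm] at hpc
    have hpc5 : ‖p - c‖ < 5 * R := by
      have : p - c = (p - (c + e)) + e := by abel
      rw [this]
      linarith [norm_add_le (p - (c + e)) e]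
    have hpc3 : 3 * R < ‖p - c‖ := by
      have : e = (p - c) - (p - (c + e)) := by abel
      have h2 := norm_sub_le (p - c) (p - (c + e))
      rw [← this, hen] at h2
      linarith
    have hsub1 : Metric.ball c R ⊆ annulus p (2 * R) (6 * R) := by
      intro x hx
      rw [Metric.mem_ball, dist_eq_norm] at hx
      have e1 : p - c = (x - c) - (x - p) := by abel
      have e2 : x - p = (x - c) - (p - c) := by abel
      have h1 := norm_sub_le (x - c) (x - p)
      have h2 := norm_sub_le (x - c) (p - c)
      rw [← e1] at h1
      rw [← e2] at h2
      exact ⟨by linarith, by linarith⟩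
    have hsub2 : annulus p (2 * R) (6 * R + 1) ⊆ Metric.ball c D := by
      intro x hx
      rw [Metric.mem_ball, dist_eq_norm]
      have e1 : x - c = (x - p) + (p - c) := by abel
      rw [e1]
      linarith [norm_add_le (x - p) (p - c), hx.2]
    have hz : ∀ t ∈ Ioo (2 * R) (6 * R), ∃ θ ∈ Icc (-Real.pi) Real.pi,
        u (polarMap p (t, θ)) = 0 := by
      intro t ht
      obtain ⟨θ, hθ, hn⟩ := exists_circle_notMem_of_isSimplyConnected hΩ hsc hp
        (t := t) (by linarith [ht.1])
      exact ⟨θ, hθ, hu.eq_zero hn⟩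
    refine (lintegral_mono_set hsub1).trans ((h u p hu.continuous hz).trans ?_)
    gcongr
    exact lintegral_mono_set (prod_mono hsub2 hsub2)
  have hg := lintegral_le_of_forall_ball hC hu.continuous hlocal
  calc ∫⁻ x, ‖u x‖ₑ ^ 2 = VR⁻¹ * (VR * ∫⁻ x, ‖u x‖ₑ ^ 2) := by
        rw [← mul_assoc, ENNReal.inv_mul_cancel hVR0 hVRt, one_mul]
    _ ≤ VR⁻¹ * (C * VD * slobodeckijEnergy volume (2 + 2 * s) u) := by gcongr
    _ = _ := by ring

/-- A Poincaré inequality for test functions extends to their closure, with a larger constant. -/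
theorem lintegral_le_of_memFracSobolevZero {s : ℝ} {Ω : Set Plane} {K : ℝ≥0∞} (hK : K ≠ ⊤)
    (h : ∀ u, IsTestFunctionOn Ω u →
      ∫⁻ x, ‖u x‖ₑ ^ 2 ≤ K * slobodeckijEnergy volume (2 + 2 * s) u)
    {u : Plane → ℝ} (hu : MemFracSobolevZero s Ω u) :
    ∫⁻ x, ‖u x‖ₑ ^ 2 ≤ 4 * K * slobodeckijEnergy volume (2 + 2 * s) u := by
  have key : ∀ ε : ℝ≥0∞, 0 < ε → ∫⁻ x, ‖u x‖ₑ ^ 2 ≤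
      4 * K * slobodeckijEnergy volume (2 + 2 * s) u + (4 * K + 2) * ε ^ 2 := by
    intro ε hε
    obtain ⟨φ, hφ, hlt⟩ := hu.2 ε hε
    have hn1 : ∫⁻ x, ‖(u - φ) x‖ₑ ^ 2 ≤ ε ^ 2 := by
      rw [← eLpNorm_two_sq]
      exact pow_le_pow_left' (le_self_add.trans hlt.le) 2
    have hn2 : slobodeckijEnergy volume (2 + 2 * s) (u - φ) ≤ ε ^ 2 := by
      have h2 := gagliardoSeminorm_sq s (u - φ)
      push_cast at h2
      rw [← h2]
      exact pow_le_pow_left' (le_add_self.trans hlt.le) 2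
    have hum : AEMeasurable u volume := hu.1.1.aestronglyMeasurable.aemeasurable
    have hneg : slobodeckijEnergy volume (2 + 2 * s) (φ - u) =
        slobodeckijEnergy volume (2 + 2 * s) (u - φ) := by
      unfold slobodeckijEnergy
      refine lintegral_congr fun p => ?_
      rw [← enorm_neg]
      congr 3
      simp only [Pi.sub_apply]; ring
    have h1 : slobodeckijEnergy volume (2 + 2 * s) φ ≤
        2 * slobodeckijEnergy volume (2 + 2 * s) u + 2 * ε ^ 2 := by
      have := slobodeckijEnergy_add_le (r := 2 + 2 * s) (φ - u) hum
      rw [add_sub_cancel, hneg] at this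
      exact this.trans (by gcongr)
    have h2 : ∫⁻ x, ‖u x‖ₑ ^ 2 ≤ 2 * (∫⁻ x, ‖φ x‖ₑ ^ 2) + 2 * ∫⁻ x, ‖(u - φ) x‖ₑ ^ 2 := by
      rw [← lintegral_const_mul' _ _ (by norm_num), ← lintegral_const_mul' _ _ (by norm_num),
        ← lintegral_add_left ((hφ.continuous.measurable.enorm.pow_const 2).const_mul 2)]
      refine lintegral_mono fun x => ?_
      have := enorm_add_sq_le (φ x) ((u - φ) x)
      rwa [Pi.sub_apply, add_sub_cancel] at this
    calc ∫⁻ x, ‖u x‖ₑ ^ 2 ≤ 2 * (∫⁻ x, ‖φ x‖ₑ ^ 2) + 2 * ∫⁻ x, ‖(u - φ) x‖ₑ ^ 2 := h2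
      _ ≤ 2 * (K * (2 * slobodeckijEnergy volume (2 + 2 * s) u + 2 * ε ^ 2)) + 2 * ε ^ 2 := by
        gcongr
        exact (h φ hφ).trans (by gcongr)
      _ = _ := by ring
  have hcont : Continuous fun ε : ℝ≥0∞ =>
      4 * K * slobodeckijEnergy volume (2 + 2 * s) u + (4 * K + 2) * ε ^ 2 := by
    refine continuous_const.add ((ENNReal.continuous_const_mul ?_).comp (ENNReal.continuous_pow 2))
    exact ENNReal.add_ne_top.2 ⟨ENNReal.mul_ne_top (by norm_num) hK, by norm_num⟩
  have hlim := (hcont.tendsto 0).mono_left (nhdsWithin_le_nhds (s := Ioi 0))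
  simp only [ne_eq, OfNat.ofNat_ne_zero, not_false_eq_true, zero_pow, mul_zero, add_zero] at hlim
  exact ge_of_tendsto hlim (by filter_upwards [self_mem_nhdsWithin] with ε hε using key ε hε)

theorem fracEigenvalue_pos_of_poincare {s : ℝ} {Ω : Set Plane} {K : ℝ≥0∞} (hK : K ≠ ⊤)
    (h : ∀ u, IsTestFunctionOn Ω u →
      ∫⁻ x, ‖u x‖ₑ ^ 2 ≤ K * slobodeckijEnergy volume (2 + 2 * s) u) :
    0 < fracEigenvalue s Ω := by
  have hK' : 4 * K + 1 ≠ ⊤ :=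
    ENNReal.add_ne_top.2 ⟨ENNReal.mul_ne_top (by norm_num) hK, by norm_num⟩
  have hK0 : 4 * K + 1 ≠ 0 := by simp
  refine lt_of_lt_of_le (ENNReal.inv_pos.2 hK') ?_
  refine le_iInf₂ fun u hu => ?_
  have h1 := lintegral_le_of_memFracSobolevZero hK h hu.1
  have h2 : eLpNorm u 2 (volume.restrict Ω) ^ 2 ≤
      (4 * K + 1) * slobodeckijEnergy volume (2 + 2 * s) u := by
    rw [eLpNorm_two_sq]
    refine (setLIntegral_le_lintegral _ _).trans (h1.trans ?_)
    gcongr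
    exact le_self_add
  have hfin : eLpNorm u 2 (volume.restrict Ω) ^ 2 ≠ ⊤ :=
    ENNReal.pow_ne_top (hu.1.1.1.restrict Ω).eLpNorm_ne_top
  have hen : slobodeckijEnergy volume (2 + 2 * s) u ≠ 0 := by
    intro h0
    rw [h0, mul_zero, nonpos_iff_eq_zero, ← eLpNorm_two_sq, pow_eq_zero_iff two_ne_zero,
      eLpNorm_eq_zero_iff hu.1.1.1.aestronglyMeasurable (by norm_num)] at h1
    exact hu.2 h1
  rw [gagliardoSeminorm_sq, ENNReal.le_div_iff_mul_le (Or.inr (by exact_mod_cast hen))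
    (Or.inl hfin)]
  push_cast
  calc (4 * K + 1)⁻¹ * eLpNorm u 2 (volume.restrict Ω) ^ 2
      ≤ (4 * K + 1)⁻¹ * ((4 * K + 1) * slobodeckijEnergy volume (2 + 2 * s) u) := by gcongr
    _ = _ := by rw [← mul_assoc, ENNReal.inv_mul_cancel hK0 hK', one_mul]

theorem exists_radius_of_inradius_lt_top {Ω : Set Plane} (h : inradius Ω < ⊤) :
    ∃ R : ℝ, 0 < R ∧ ∀ c : Plane, ∃ p ∉ Ω, dist p c < R := by
  obtain ⟨R, hR0, hR⟩ : ∃ R : ℝ, 0 < R ∧ inradius Ω < ENNReal.ofReal R := by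
    refine ⟨(inradius Ω).toReal + 1, by positivity, ?_⟩
    rw [ENNReal.lt_ofReal_iff_toReal_lt h.ne]
    linarith
  refine ⟨R, hR0, fun c => ?_⟩
  by_contra hcon
  push Not at hcon
  have hsub : Metric.ball c R ⊆ Ω := by
    intro x hx
    by_contra hxn
    exact absurd (hcon x hxn) (not_le.2 hx)
  refine absurd hR (not_lt.2 ?_)
  exact le_iSup₂_of_le R ⟨hR0, c, hsub (Metric.mem_ball_self hR0), hsub⟩ le_rfl

theorem fracEigenvalue_pos_of_inradius_lt_top {s : ℝ} (hs : 1 / 2 < s)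
    {Ω : Set Plane} (hΩ : IsOpen Ω) (hsc : IsSimplyConnected Ω) (h : inradius Ω < ⊤) :
    0 < fracEigenvalue s Ω := by
  obtain ⟨R, hR, hball⟩ := exists_radius_of_inradius_lt_top h
  obtain ⟨K, hK, hP⟩ := exists_poincare_of_isSimplyConnected hs hR hΩ hsc hball
  exact fracEigenvalue_pos_of_poincare hK hP

/-! ### Topology and inradius of the complement comb -/

theorem mem_complementComb {p : Plane} :
    p ∈ complementComb ↔ |p 0| < 1 ∨ ∀ i : ℤ, p 1 ≠ i := by
  simp only [complementComb, infiniteComb, mem_compl_iff, mem_iUnion, mem_ofPred_eq, not_exists,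
    not_and]
  constructor
  · intro h
    by_contra! hcon
    obtain ⟨h1, i, hi⟩ := hcon
    exact h i h1 hi
  · rintro (h | h) i h1
    · exact absurd h1 (not_le.2 h)
    · exact h i

theorem isOpen_complementComb : IsOpen complementComb := by
  have hset : complementComb =
      {p : Plane | |p 0| < 1} ∪ (fun p : Plane => p 1) ⁻¹' (range ((↑) : ℤ → ℝ))ᶜ := by
    ext p
    rw [mem_complementComb]
    simp [eq_comm]
  rw [hset]
  refine (isOpen_lt (by fun_prop) continuous_const).union (IsOpen.preimage (by fun_prop) ?_)
  exact Int.isClosedEmbedding_coe_real.isClosed_range.isOpen_compl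

/-- The complement comb contracts horizontally onto the vertical axis, which contracts to `0`. -/
theorem isSimplyConnected_complementComb : IsSimplyConnected complementComb := by
  have hH : ∀ (t : unitInterval) (p : complementComb),
      toPlane ((1 - t) * (p : Plane) 0, (p : Plane) 1) ∈ complementComb := by
    intro t p
    rw [mem_complementComb]
    refine (mem_complementComb.1 p.2).imp (fun h => ?_) fun h => h
    rw [toPlane_zero, abs_mul, abs_of_nonneg (by linarith [t.2.2])]
    exact (mul_le_of_le_one_left (abs_nonneg _) (by linarith [t.2.1])).trans_lt h
  have hV : ∀ (t : unitInterval) (p : complementComb),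
      toPlane (0, (1 - t) * (p : Plane) 1) ∈ complementComb := by
    intro t p
    rw [mem_complementComb]
    left
    simp
  let H : ContinuousMap.Homotopy (ContinuousMap.id complementComb)
      ⟨fun p => ⟨_, hH 1 p⟩, (continuous_toPlane.comp (by fun_prop)).subtype_mk _⟩ :=
    { toFun := fun q => ⟨_, hH q.1 q.2⟩
      continuous_toFun := (continuous_toPlane.comp (by fun_prop)).subtype_mk _
      map_zero_left := fun p => by
        ext i
        fin_cases i <;> simp
      map_one_left := fun p => rfl }
  let V : ContinuousMap.Homotopy
      (⟨fun p => ⟨_, hH 1 p⟩, (continuous_toPlane.comp (by fun_prop)).subtype_mk _⟩ :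
        C(complementComb, complementComb))
      (ContinuousMap.const _ ⟨toPlane (0, 0), by simp [mem_complementComb]⟩) :=
    { toFun := fun q => ⟨_, hV q.1 q.2⟩
      continuous_toFun := (continuous_toPlane.comp (by fun_prop)).subtype_mk _
      map_zero_left := fun p => by
        ext i
        fin_cases i <;> simp
      map_one_left := fun p => by
        ext i
        fin_cases i <;> simp }
  have : ContractibleSpace complementComb :=
    (contractible_iff_id_nullhomotopic _).2 ⟨_, ⟨H.trans V⟩⟩
  exact SimplyConnectedSpace.ofContractible _

theorem inradius_complementComb_lt_top : inradius complementComb < ⊤ := by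
  refine lt_of_le_of_lt (iSup₂_le fun ρ hρ => ?_) (ENNReal.ofReal_lt_top (r := 3))
  obtain ⟨-, x, -, hball⟩ := hρ
  refine ENNReal.ofReal_le_ofReal ?_
  by_contra! hcon
  set e : ℝ := if 0 ≤ x 0 then 1 else -1 with he
  have hy : toPlane (x 0 + e, ⌊x 1⌋) ∈ Metric.ball x ρ := by
    rw [Metric.mem_ball, dist_eq_norm]
    have hsub : toPlane (x 0 + e, ⌊x 1⌋) - x = toPlane (e, ⌊x 1⌋ - x 1) := by
      ext i
      fin_cases i <;> simp
    rw [hsub, norm_toPlane]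
    refine lt_trans ((Real.sqrt_lt' (by norm_num : (0 : ℝ) < 3)).2 ?_) hcon
    have h1 := Int.floor_le (x 1)
    have h2 := Int.lt_floor_add_one (x 1)
    have h3 : e ^ 2 = 1 := by rw [he]; split_ifs <;> norm_num
    simp only
    rw [h3]
    nlinarith
  have hmem := hball hy
  rw [mem_complementComb] at hmem
  rcases hmem with h | h
  · rw [toPlane_zero, abs_lt, he] at h
    simp only at h
    split_ifs at h with h0
    · linarith
    · linarith
  · exact h ⌊x 1⌋ rfl

/-! ### Capacity of a point of the line -/

/-- A smooth compactly supported function on the line with values in `[0, 1]`, equal to `1` near the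
origin: a competitor for the capacity of the point `0`. -/
structure IsPointCutoff (η : ℝ → ℝ) : Prop where
  contDiff : ContDiff ℝ (⊤ : ℕ∞) η
  hasCompactSupport : HasCompactSupport η
  nonneg : ∀ x, 0 ≤ η x
  le_one : ∀ x, η x ≤ 1
  eventually_eq_one : ∀ᶠ x in nhds 0, η x = 1

theorem exists_isPointCutoff : ∃ η, IsPointCutoff η := by
  let f : ContDiffBump (0 : ℝ) := ⟨1, 2, by norm_num, by norm_num⟩
  exact ⟨f, f.contDiff, f.hasCompactSupport, fun _ => f.nonneg, fun _ => f.le_one,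
    f.eventuallyEq_one⟩

namespace IsPointCutoff

variable {η : ℝ → ℝ}

theorem energy_lt_top (hη : IsPointCutoff η) {r : ℝ} (hr : 1 < r) (hr' : r < 3) :
    slobodeckijEnergy volume r η < ⊤ := by
  refine slobodeckijEnergy_smooth_lt_top volume ?_ ?_ hη.contDiff hη.hasCompactSupport <;>
  · simp only [Module.finrank_self]
    push_cast
    linarith

theorem lintegral_lt_top (hη : IsPointCutoff η) : ∫⁻ x, ‖η x‖ₑ ^ 2 < ⊤ := by
  rw [← eLpNorm_two_sq]
  exact ENNReal.pow_lt_top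
    (hη.contDiff.continuous.memLp_of_hasCompactSupport hη.hasCompactSupport).eLpNorm_lt_top

theorem comp_smul (hη : IsPointCutoff η) {c : ℝ} (hc : 0 < c) :
    IsPointCutoff fun x => η (c • x) where
  contDiff := hη.contDiff.comp (by fun_prop : ContDiff ℝ (⊤ : ℕ∞) fun x : ℝ => c • x)
  hasCompactSupport := hη.hasCompactSupport.comp_homeomorph (Homeomorph.smulOfNeZero c hc.ne')
  nonneg x := hη.nonneg _
  le_one x := hη.le_one _
  eventually_eq_one := by
    have h : Filter.Tendsto (fun x : ℝ => c • x) (nhds 0) (nhds 0) := by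
      have : Continuous fun x : ℝ => c • x := by fun_prop
      simpa using this.tendsto 0
    exact h.eventually hη.eventually_eq_one

theorem average (hη : IsPointCutoff η) {ζ : ℝ → ℝ} (hζ : IsPointCutoff ζ) :
    IsPointCutoff fun x => (η x + ζ x) / 2 where
  contDiff := (hη.contDiff.add hζ.contDiff).div_const 2
  hasCompactSupport := by
    have h := (hη.hasCompactSupport.add hζ.hasCompactSupport).comp_left (g := fun x : ℝ => x / 2)
      (by simp)
    exact h
  nonneg x := by linarith [hη.nonneg x, hζ.nonneg x]
  le_one x := by linarith [hη.le_one x, hζ.le_one x]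
  eventually_eq_one := by
    filter_upwards [hη.eventually_eq_one, hζ.eventually_eq_one] with x h1 h2
    rw [h1, h2]; norm_num

theorem enorm_sub_le_one (hη : IsPointCutoff η) (x y : ℝ) : ‖η x - η y‖ₑ ≤ 1 := by
  rw [← ofReal_norm, ENNReal.ofReal_le_one, Real.norm_eq_abs, abs_le]
  constructor <;> linarith [hη.nonneg x, hη.nonneg y, hη.le_one x, hη.le_one y]

theorem energy_comp_smul_le (η : ℝ → ℝ) {r c : ℝ} (hr : r ≤ 2) (hc : 1 ≤ c) :
    slobodeckijEnergy volume r (fun x => η (c • x)) ≤ slobodeckijEnergy volume r η := by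
  rw [slobodeckijEnergy_comp_smul r η (by linarith)]
  refine mul_le_of_le_one_left zero_le ?_
  rw [Module.finrank_self, ENNReal.ofReal_rpow_of_pos (by linarith), ENNReal.ofReal_le_one]
  refine Real.rpow_le_one_of_one_le_of_nonpos hc ?_
  push_cast
  linarith

/-- The interaction energy of a cutoff and its concentrated rescaling: where the second one varies,
the first one is constant equal to `1`, so that only pairs at distance at least `a / 2` count. -/
theorem lintegral_cross_le (hη : IsPointCutoff η) {r a b c : ℝ} (hc : 0 < c)
    (ha1 : ∀ x, |x| < a → η x = 1) (hb : ∀ x, b ≤ |x| → η x = 0)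
    (hbc : b / c ≤ a / 2) :
    ∫⁻ p : ℝ × ℝ, ‖η p.1 - η p.2‖ₑ * ‖η (c • p.1) - η (c • p.2)‖ₑ / ‖p.1 - p.2‖ₑ ^ r
        ∂(volume.prod volume) ≤
      2 * (ENNReal.ofReal (2 * (b / c)) *
        ∫⁻ z : ℝ, {z : ℝ | a / 2 ≤ |z|}.indicator (fun z => (‖z‖ₑ ^ r)⁻¹) z) := by
  set k : ℝ → ℝ≥0∞ := {z : ℝ | a / 2 ≤ |z|}.indicator (fun z => (‖z‖ₑ ^ r)⁻¹) with hk
  have hkm : Measurable k :=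
    (measurable_enorm.pow_const r).inv.indicator
      (isClosed_le continuous_const continuous_abs).measurableSet
  set S : Set ℝ := Ioo (-(b / c)) (b / c) with hS
  have hSm : MeasurableSet S := measurableSet_Ioo
  have hvol : volume S = ENNReal.ofReal (2 * (b / c)) := by
    rw [hS, Real.volume_Ioo]; congr 1; ring
  have hind : Measurable (S.indicator (1 : ℝ → ℝ≥0∞)) := measurable_one.indicator hSm
  have hout : ∀ x, x ∉ S → η (c • x) = 0 := by
    intro x hx
    refine hb _ ?_
    rw [hS, mem_Ioo, ← abs_lt, not_lt, div_le_iff₀ hc] at hx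
    rwa [smul_eq_mul, abs_mul, abs_of_pos hc, mul_comm]
  have hin : ∀ x y, x ∈ S → ‖η x - η y‖ₑ * ‖η (c • x) - η (c • y)‖ₑ / ‖x - y‖ₑ ^ r ≤
      k (x - y) := by
    intro x y hx
    rw [hS, mem_Ioo, ← abs_lt] at hx
    have ha0 : 0 < a := by linarith [(abs_nonneg x).trans_lt hx]
    have hx1 : η x = 1 := ha1 x (by linarith)
    by_cases hy : |y| < a
    · simp [hx1, ha1 y hy]
    · have hd : a / 2 ≤ |x - y| := by
        have h1 := abs_sub_abs_le_abs_sub y x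
        rw [abs_sub_comm y x] at h1
        linarith
      simp only [hk]
      rw [indicator_of_mem (by exact hd), div_eq_mul_inv]
      refine mul_le_of_le_one_left zero_le ?_
      exact mul_le_one' (hη.enorm_sub_le_one _ _) (hη.enorm_sub_le_one _ _)
  have hbound : ∀ p : ℝ × ℝ,
      ‖η p.1 - η p.2‖ₑ * ‖η (c • p.1) - η (c • p.2)‖ₑ / ‖p.1 - p.2‖ₑ ^ r ≤
      S.indicator 1 p.1 * k (p.1 - p.2) + S.indicator 1 p.2 * k (p.2 - p.1) := by
    intro p
    by_cases h1 : p.1 ∈ S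
    · exact (hin p.1 p.2 h1).trans (by simp [h1])
    by_cases h2 : p.2 ∈ S
    · have h3 := hin p.2 p.1 h2
      rw [← enorm_neg (η p.2 - η p.1), ← enorm_neg (η (c • p.2) - η (c • p.1)),
        ← enorm_neg (p.2 - p.1), neg_sub, neg_sub, neg_sub] at h3
      exact h3.trans (by simp [h2])
    · rw [hout p.1 h1, hout p.2 h2]
      simp
  have hA : ∫⁻ p : ℝ × ℝ, S.indicator 1 p.1 * k (p.1 - p.2) ∂(volume.prod volume) =
      volume S * ∫⁻ z, k z := by
    rw [lintegral_prod _ (by fun_prop)]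
    have : ∀ x, ∫⁻ y, S.indicator 1 x * k (x - y) = S.indicator 1 x * ∫⁻ z, k z := by
      intro x
      rw [lintegral_const_mul _ (by fun_prop), lintegral_sub_left_eq_self]
    simp_rw [this]
    rw [lintegral_mul_const _ hind, lintegral_indicator_one hSm]
  have hB : ∫⁻ p : ℝ × ℝ, S.indicator 1 p.2 * k (p.2 - p.1) ∂(volume.prod volume) =
      volume S * ∫⁻ z, k z := by
    rw [← hA, ← lintegral_prod_swap]
    rfl
  refine (lintegral_mono hbound).trans ?_
  rw [lintegral_add_left (by fun_prop), hA, hB, hvol, ← two_mul]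

theorem lintegral_tail_lt_top {r a : ℝ} (hr : 1 < r) (hr' : r < 3) (ha : 0 < a) :
    ∫⁻ z : ℝ, {z : ℝ | a / 2 ≤ |z|}.indicator (fun z => (‖z‖ₑ ^ r)⁻¹) z < ⊤ := by
  refine lt_of_le_of_lt (lintegral_mono fun z => ?_)
    (lintegral_min_div_rpow_lt_top (volume : Measure ℝ) (r := r) (C := 1) (L := 2 / a)
      zero_le_one (by simpa using hr) (by simp only [Module.finrank_self]; push_cast; linarith))
  by_cases hz : z ∈ {z : ℝ | a / 2 ≤ |z|}
  · rw [indicator_of_mem hz]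
    have hz' : a / 2 ≤ |z| := hz
    have hz0 : 0 < ‖z‖ := by rw [Real.norm_eq_abs]; linarith
    have h1 : (1 : ℝ) ≤ (2 / a) ^ 2 * ‖z‖ ^ 2 := by
      rw [← mul_pow]
      refine one_le_pow₀ ?_
      rw [Real.norm_eq_abs, div_mul_eq_mul_div, one_le_div ha]
      linarith
    rw [min_eq_left h1, ← ofReal_norm, ENNReal.ofReal_rpow_of_pos hz0,
      ← ENNReal.ofReal_inv_of_pos (by positivity), one_div]
  · rw [indicator_of_notMem hz]
    exact zero_le

/-- Averaging a cutoff with a very concentrated rescaling of itself nearly halves the energy, since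
for `r ≤ 2` the rescaling does not increase the energy and the interaction is negligible. -/
theorem exists_energy_le_half (hη : IsPointCutoff η) {r : ℝ} (hr : 1 < r) (hr' : r ≤ 2)
    {δ : ℝ≥0∞} (hδ : 0 < δ) : ∃ ζ, IsPointCutoff ζ ∧
      slobodeckijEnergy volume r ζ ≤ slobodeckijEnergy volume r η / 2 + δ := by
  obtain ⟨a, ha, ha1⟩ := Metric.eventually_nhds_iff.1 hη.eventually_eq_one
  simp only [Real.dist_eq, sub_zero] at ha1
  obtain ⟨b, hb⟩ := hη.hasCompactSupport.isCompact.isBounded.subset_ball (0 : ℝ)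
  have hb' : ∀ x, b ≤ |x| → η x = 0 := by
    intro x hx
    refine image_eq_zero_of_notMem_tsupport fun hmem => ?_
    have := hb hmem
    rw [mem_ball_zero_iff, Real.norm_eq_abs] at this
    linarith
  set J := ∫⁻ z : ℝ, {z : ℝ | a / 2 ≤ |z|}.indicator (fun z => (‖z‖ₑ ^ r)⁻¹) z
  have hJt : J ≠ ⊤ := (lintegral_tail_lt_top hr (by linarith) ha).ne
  have hlim0 : Filter.Tendsto (fun c : ℝ => b / c) Filter.atTop (nhds 0) :=
    Filter.tendsto_id.const_div_atTop b
  have hlim : Filter.Tendsto (fun c : ℝ => 2 * (ENNReal.ofReal (2 * (b / c)) * J)) Filter.atTop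
      (nhds 0) := by
    have h1 := ENNReal.tendsto_ofReal (hlim0.const_mul 2)
    have h2 := ENNReal.Tendsto.const_mul (a := 2)
      (ENNReal.Tendsto.mul_const h1 (Or.inr hJt)) (Or.inr (by norm_num))
    simpa using h2
  obtain ⟨c, hc1, hc2, hc3⟩ := ((Filter.eventually_ge_atTop (1 : ℝ)).and
    ((hlim.eventually_lt_const hδ).and (hlim0.eventually_le_const (half_pos ha)))).exists
  have hc0 : 0 < c := by linarith
  refine ⟨_, hη.average (hη.comp_smul hc0), ?_⟩
  have hcross := hη.lintegral_cross_le (r := r) hc0 (fun x hx => ha1 hx) hb' hc3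
  have hscale := energy_comp_smul_le η hr' hc1
  have hη1 : Measurable η := hη.contDiff.continuous.measurable
  have hη2 : Measurable fun x : ℝ => η (c • x) := (hη.comp_smul hc0).contDiff.continuous.measurable
  have h4 : (4 : ℝ≥0∞)⁻¹ ≠ ⊤ := by simp
  have hpt : ∀ p : ℝ × ℝ,
      ‖(η p.1 + η (c • p.1)) / 2 - (η p.2 + η (c • p.2)) / 2‖ₑ ^ 2 / ‖p.1 - p.2‖ₑ ^ r ≤
      4⁻¹ * (‖η p.1 - η p.2‖ₑ ^ 2 / ‖p.1 - p.2‖ₑ ^ r +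
        (‖η (c • p.1) - η (c • p.2)‖ₑ ^ 2 / ‖p.1 - p.2‖ₑ ^ r +
        2 * (‖η p.1 - η p.2‖ₑ * ‖η (c • p.1) - η (c • p.2)‖ₑ / ‖p.1 - p.2‖ₑ ^ r))) := by
    intro p
    have e1 : (η p.1 + η (c • p.1)) / 2 - (η p.2 + η (c • p.2)) / 2 =
        2⁻¹ * ((η p.1 - η p.2) + (η (c • p.1) - η (c • p.2))) := by ring
    have e2 : ‖(2⁻¹ : ℝ)‖ₑ ^ 2 = 4⁻¹ := by
      rw [enorm_inv (by norm_num), ← ENNReal.inv_pow]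
      congr 1
      rw [Real.enorm_eq_ofReal (by norm_num)]
      norm_num
    have e3 : (‖η p.1 - η p.2‖ₑ + ‖η (c • p.1) - η (c • p.2)‖ₑ) ^ 2 =
        ‖η p.1 - η p.2‖ₑ ^ 2 + (‖η (c • p.1) - η (c • p.2)‖ₑ ^ 2 +
          2 * (‖η p.1 - η p.2‖ₑ * ‖η (c • p.1) - η (c • p.2)‖ₑ)) := by ring
    rw [e1, enorm_mul, mul_pow, e2, mul_div_assoc, ← mul_div_assoc 2, ← ENNReal.add_div,
      ← ENNReal.add_div, ← e3]
    gcongr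
    exact enorm_add_le _ _
  unfold slobodeckijEnergy
  refine (lintegral_mono hpt).trans ?_
  rw [lintegral_const_mul' _ _ h4, lintegral_add_left (measurable_slobodeckij hη1 r),
    lintegral_add_left (measurable_slobodeckij hη2 r), lintegral_const_mul' _ _ (by norm_num)]
  set E := slobodeckijEnergy volume r η
  calc _ ≤ (4 : ℝ≥0∞)⁻¹ * (E + (E + 2 * δ)) := by
        gcongr
        · exact le_rfl
        · exact hscale
        · exact hcross.trans hc2.le
    _ = 4⁻¹ * (2 * E) + 4⁻¹ * (2 * δ) := by ring
    _ ≤ E / 2 + δ := by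
        have e1 : (4 : ℝ≥0∞)⁻¹ * 2 = 2⁻¹ := by
          rw [show (4 : ℝ≥0∞) = 2 * 2 by norm_num, ENNReal.mul_inv (by simp) (by simp), mul_assoc,
            ENNReal.inv_mul_cancel (by simp) (by simp), mul_one]
        rw [← mul_assoc, ← mul_assoc, e1, div_eq_mul_inv, mul_comm E]
        gcongr
        exact mul_le_of_le_one_left zero_le (by simp)

end IsPointCutoff

/-- A point of the line has zero capacity for the energy of exponent `r = 1 + 2 s ≤ 2`. -/
theorem exists_isPointCutoff_energy_le {r : ℝ} (hr : 1 < r) (hr' : r ≤ 2) {δ : ℝ≥0∞}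
    (hδ : 0 < δ) : ∃ η, IsPointCutoff η ∧ slobodeckijEnergy volume r η ≤ δ ∧
      ∫⁻ x, ‖η x‖ₑ ^ 2 ≤ δ := by
  obtain ⟨η₀, hη₀⟩ := exists_isPointCutoff
  set E := slobodeckijEnergy volume r η₀
  have hEt : E ≠ ⊤ := (hη₀.energy_lt_top hr (by linarith)).ne
  have hδ2 : 0 < δ / 2 := ENNReal.half_pos hδ.ne'
  have hiter : ∀ n : ℕ, ∃ η, IsPointCutoff η ∧
      slobodeckijEnergy volume r η ≤ E * 2⁻¹ ^ n + δ / 2 := by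
    intro n
    induction n with
    | zero => exact ⟨η₀, hη₀, by rw [pow_zero, mul_one]; exact le_self_add⟩
    | succ n ih =>
      obtain ⟨η, hη, hle⟩ := ih
      obtain ⟨ζ, hζ, hle'⟩ := hη.exists_energy_le_half hr hr' (ENNReal.half_pos hδ2.ne')
      refine ⟨ζ, hζ, hle'.trans ?_⟩
      calc slobodeckijEnergy volume r η / 2 + δ / 2 / 2
          ≤ (E * 2⁻¹ ^ n + δ / 2) / 2 + δ / 2 / 2 := by gcongr
        _ = E * 2⁻¹ ^ (n + 1) + (δ / 2 / 2 + δ / 2 / 2) := by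
          rw [ENNReal.add_div, pow_succ, div_eq_mul_inv (E * 2⁻¹ ^ n)]; ring
        _ = _ := by rw [ENNReal.add_halves]
  have hlim : Filter.Tendsto (fun n : ℕ => E * 2⁻¹ ^ n) Filter.atTop (nhds 0) := by
    have h := ENNReal.Tendsto.const_mul (a := E)
      (ENNReal.tendsto_pow_atTop_nhds_zero_of_lt_one (r := 2⁻¹) (by simp)) (Or.inr hEt)
    simpa using h
  obtain ⟨n, hn⟩ := (hlim.eventually_lt_const hδ2).exists
  obtain ⟨η, hη, hle⟩ := hiter n
  set I := ∫⁻ x, ‖η x‖ₑ ^ 2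
  have hlim2 : Filter.Tendsto (fun c : ℝ => ENNReal.ofReal c⁻¹ * I) Filter.atTop (nhds 0) := by
    have h := ENNReal.Tendsto.mul_const (b := I) (ENNReal.tendsto_ofReal tendsto_inv_atTop_zero)
      (Or.inr hη.lintegral_lt_top.ne)
    simpa using h
  -- A final rescaling makes the `L²` norm small as well.
  obtain ⟨c, hc, hcI⟩ := ((Filter.eventually_ge_atTop (1 : ℝ)).and
    (hlim2.eventually_lt_const hδ)).exists
  have hc0 : 0 < c := by linarith
  refine ⟨_, hη.comp_smul hc0, ?_, ?_⟩
  · refine (IsPointCutoff.energy_comp_smul_le η hr' hc).trans (hle.trans ?_)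
    calc E * 2⁻¹ ^ n + δ / 2 ≤ δ / 2 + δ / 2 := by gcongr
      _ = δ := ENNReal.add_halves δ
  · rw [lintegral_comp_smul_of_pos volume (fun x => ‖η x‖ₑ ^ 2) hc0, Module.finrank_self,
      Nat.cast_one, ENNReal.rpow_neg_one, ← ENNReal.ofReal_inv_of_pos hc0]
    exact hcI.le

/-! ### The eigenvalue of the complement comb -/

theorem lintegral_inv_one_add_sq_eq_pi :
    ∫⁻ x : ℝ, ENNReal.ofReal (1 + x ^ 2)⁻¹ = ENNReal.ofReal Real.pi := by
  rw [← ofReal_integral_eq_lintegral_ofReal integrable_inv_one_add_sq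
    (Filter.Eventually.of_forall fun x => by positivity), integral_univ_inv_one_add_sq]

/-- Integrating the planar kernel along a line at distance `|h|` gives at most `π` times the
one-dimensional kernel of the same order `s`. -/
theorem lintegral_kernel_line_le {s : ℝ} (hs : 0 ≤ s) (c : ℝ) {h : ℝ} (hh : h ≠ 0) :
    ∫⁻ x : ℝ, (‖toPlane (c - x, h)‖ₑ ^ (2 + 2 * s))⁻¹ ≤
      ENNReal.ofReal Real.pi / ‖h‖ₑ ^ (1 + 2 * s) := by
  have hh0 : 0 < |h| := abs_pos.2 hh
  rw [lintegral_sub_left_eq_self fun x : ℝ => (‖toPlane (x, h)‖ₑ ^ (2 + 2 * s))⁻¹]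
  have hpt : ∀ x : ℝ, (‖toPlane (x, h)‖ₑ ^ (2 + 2 * s))⁻¹ ≤
      ENNReal.ofReal (|h| ^ (2 + 2 * s))⁻¹ *
        ENNReal.ofReal (1 + (|h|⁻¹ • x) ^ 2)⁻¹ := by
    intro x
    set m := ‖toPlane (x, h)‖ with hm
    have hm2 : m ^ 2 = x ^ 2 + h ^ 2 := by
      rw [hm, norm_toPlane, Real.sq_sqrt (by positivity)]
    have hmh : |h| ≤ m := by
      rw [hm, norm_toPlane]
      exact Real.abs_le_sqrt (by simp only; nlinarith [sq_nonneg x])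
    have hm0 : 0 < m := hh0.trans_le hmh
    rw [← ofReal_norm, ← hm, ENNReal.ofReal_rpow_of_pos hm0,
      ← ENNReal.ofReal_inv_of_pos (by positivity), ← ENNReal.ofReal_mul (by positivity),
      ← mul_inv]
    refine ENNReal.ofReal_le_ofReal (inv_anti₀ (by positivity) ?_)
    have e1 : (1 + (|h|⁻¹ • x) ^ 2) * |h| ^ 2 = m ^ 2 := by
      rw [hm2, smul_eq_mul, mul_pow, inv_pow, sq_abs]
      field_simp
      ring
    have hc : ∀ y : ℝ, 0 < y → y ^ (2 + 2 * s) = y ^ (2 * s) * y ^ 2 := by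
      intro y hy
      rw [add_comm, Real.rpow_add hy]
      norm_cast
    rw [hc m hm0, hc _ hh0, mul_assoc, mul_comm (|h| ^ 2), e1]
    gcongr
  refine (lintegral_mono hpt).trans (le_of_eq ?_)
  rw [lintegral_const_mul' _ _ ENNReal.ofReal_ne_top,
    lintegral_comp_smul_of_pos volume (fun x : ℝ => ENNReal.ofReal (1 + x ^ 2)⁻¹)
      (inv_pos.2 hh0), lintegral_inv_one_add_sq_eq_pi, Module.finrank_self, Nat.cast_one,
    ENNReal.rpow_neg_one, ← ENNReal.ofReal_inv_of_pos (inv_pos.2 hh0), inv_inv, ← ofReal_norm,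
    Real.norm_eq_abs, ENNReal.ofReal_rpow_of_pos hh0, ← ENNReal.ofReal_div_of_pos (by positivity),
    ← ENNReal.ofReal_mul (by positivity), ← ENNReal.ofReal_mul (by positivity)]
  congr 1
  have e2 : |h| ^ (2 + 2 * s) = |h| * |h| ^ (1 + 2 * s) := by
    rw [show 2 + 2 * s = 1 + (1 + 2 * s) by ring, Real.rpow_add hh0, Real.rpow_one]
  rw [e2]
  field_simp

theorem lintegral_toPlane {f : Plane → ℝ≥0∞} (hf : Measurable f) :
    ∫⁻ q, f q = ∫⁻ y : ℝ, ∫⁻ x : ℝ, f (toPlane (x, y)) := by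
  rw [← measurePreserving_toPlane.lintegral_comp_emb measurableEmbedding_toPlane,
    Measure.volume_eq_prod]
  exact lintegral_prod_symm (fun q => f (toPlane q))
    (hf.comp measurableEmbedding_toPlane.measurable).aemeasurable

theorem lintegral_slab (a : ℝ) {f : ℝ → ℝ≥0∞} (hf : Measurable f) :
    ∫⁻ p : Plane, {p : Plane | |p 0| ≤ a}.indicator (fun p => f (p 1)) p =
      ENNReal.ofReal (2 * a) * ∫⁻ y, f y := by
  rw [← measurePreserving_toPlane.lintegral_comp_emb measurableEmbedding_toPlane]
  have e1 : ∀ q : ℝ × ℝ, {p : Plane | |p 0| ≤ a}.indicator (fun p => f (p 1)) (toPlane q) =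
      (Icc (-a) a).indicator 1 q.1 * f q.2 := by
    intro q
    simp only [indicator, mem_ofPred_eq, toPlane_zero, toPlane_one, mem_Icc, abs_le, Pi.one_apply]
    split_ifs <;> simp
  simp_rw [e1]
  rw [Measure.volume_eq_prod, lintegral_prod_mul
    (measurable_one.indicator measurableSet_Icc).aemeasurable hf.aemeasurable,
    lintegral_indicator_one measurableSet_Icc, Real.volume_Icc]
  congr 2
  ring

theorem lintegral_slobodeckij_fibre_le {s : ℝ} (hs : 0 ≤ s) {g : ℝ → ℝ} (hg : Measurable g)
    (p : Plane) :
    ∫⁻ q : Plane, ‖g (p 1) - g (q 1)‖ₑ ^ 2 / ‖p - q‖ₑ ^ (2 + 2 * s) ≤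
      ENNReal.ofReal Real.pi * ∫⁻ y, ‖g (p 1) - g y‖ₑ ^ 2 / ‖p 1 - y‖ₑ ^ (1 + 2 * s) := by
  have hc1 : Measurable fun q : Plane => q 1 :=
    (by fun_prop : Continuous fun q : Plane => q 1).measurable
  have hm : Measurable fun q : Plane => ‖g (p 1) - g (q 1)‖ₑ ^ 2 / ‖p - q‖ₑ ^ (2 + 2 * s) :=
    ((measurable_const.sub (hg.comp hc1)).enorm.pow_const 2).div
      ((measurable_const.sub measurable_id).enorm.pow_const _)
  rw [lintegral_toPlane hm, ← lintegral_const_mul' _ _ ENNReal.ofReal_ne_top]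
  refine lintegral_mono fun y => ?_
  by_cases hy : p 1 = y
  · simp [hy]
  have e1 : ∀ x : ℝ, p - toPlane (x, y) = toPlane (p 0 - x, p 1 - y) := by
    intro x
    ext i
    fin_cases i <;> simp
  simp only [e1, toPlane_one, div_eq_mul_inv]
  rw [lintegral_const_mul' _ _ (by simp), mul_left_comm, ← div_eq_mul_inv (ENNReal.ofReal _)]
  gcongr
  exact lintegral_kernel_line_le hs _ (sub_ne_zero.2 hy)

/-- For a function of the second coordinate only, the planar energy over a slab is controlled by the
one-dimensional energy. -/
theorem lintegral_slab_energy_le {s : ℝ} (hs : 0 ≤ s) (a : ℝ) {g : ℝ → ℝ} (hg : Measurable g) :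
    ∫⁻ p : Plane × Plane, {p : Plane | |p 0| ≤ a}.indicator 1 p.1 *
      (‖g (p.1 1) - g (p.2 1)‖ₑ ^ 2 / ‖p.1 - p.2‖ₑ ^ (2 + 2 * s)) ∂(volume.prod volume) ≤
      ENNReal.ofReal (2 * a) * (ENNReal.ofReal Real.pi *
        slobodeckijEnergy volume (1 + 2 * s) g) := by
  have hc1 : Measurable fun p : Plane => p 1 :=
    (by fun_prop : Continuous fun p : Plane => p 1).measurable
  have hset : MeasurableSet {p : Plane | |p 0| ≤ a} :=
    (isClosed_le (by fun_prop) continuous_const).measurableSet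
  have hind : Measurable ({p : Plane | |p 0| ≤ a}.indicator (1 : Plane → ℝ≥0∞)) :=
    measurable_one.indicator hset
  have hker := measurable_slobodeckij (hg.comp hc1) (2 + 2 * s)
  have hinner := lintegral_slobodeckij_fibre_le hs hg
  have hIm : Measurable fun t => ∫⁻ y, ‖g t - g y‖ₑ ^ 2 / ‖t - y‖ₑ ^ (1 + 2 * s) :=
    (measurable_slobodeckij hg (1 + 2 * s)).lintegral_prod_right'
  obtain ⟨K, hK⟩ : ∃ K : Plane → Plane → ℝ≥0∞, ∀ p q,
    K p q = ‖g (p 1) - g (q 1)‖ₑ ^ 2 / ‖p - q‖ₑ ^ (2 + 2 * s) := ⟨_, fun _ _ => rfl⟩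
  obtain ⟨I, hI⟩ : ∃ I : ℝ → ℝ≥0∞, ∀ t,
    I t = ∫⁻ y, ‖g t - g y‖ₑ ^ 2 / ‖t - y‖ₑ ^ (1 + 2 * s) := ⟨_, fun _ => rfl⟩
  have hE : slobodeckijEnergy volume (1 + 2 * s) g = ∫⁻ t, I t := by
    unfold slobodeckijEnergy
    rw [lintegral_prod _ (measurable_slobodeckij hg _).aemeasurable]
    simp_rw [hI]
  simp only [Function.comp_apply, ← hK] at hker
  simp_rw [← hK, ← hI] at hinner
  simp_rw [← hI] at hIm
  simp_rw [← hK]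
  have hprod : Measurable fun p : Plane × Plane =>
      {p : Plane | |p 0| ≤ a}.indicator (1 : Plane → ℝ≥0∞) p.1 * K p.1 p.2 :=
    (hind.comp measurable_fst).mul hker
  rw [lintegral_prod _ hprod.aemeasurable, hE]
  calc _ ≤ ∫⁻ p : Plane, ENNReal.ofReal Real.pi *
        {p : Plane | |p 0| ≤ a}.indicator (fun p => I (p 1)) p := by
        refine lintegral_mono fun p => ?_
        simp only
        rw [lintegral_const_mul' _ (K p) (by by_cases hp : |p 0| ≤ a <;> simp [indicator, hp])]
        by_cases hp : p ∈ {p : Plane | |p 0| ≤ a}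
        · rw [indicator_of_mem hp, indicator_of_mem hp, Pi.one_apply, one_mul]
          exact hinner p
        · rw [indicator_of_notMem hp, zero_mul]
          exact zero_le
    _ = ENNReal.ofReal (2 * a) * (ENNReal.ofReal Real.pi * ∫⁻ t, I t) := by
        rw [lintegral_const_mul' _ _ ENNReal.ofReal_ne_top, lintegral_slab a hIm]
        ring

theorem abs_prod_sub_prod_le_sum {ι : Type*} (F : Finset ι) {a b : ι → ℝ}
    (ha : ∀ i, |a i| ≤ 1) (hb : ∀ i, |b i| ≤ 1) :
    |∏ i ∈ F, a i - ∏ i ∈ F, b i| ≤ ∑ i ∈ F, |a i - b i| := by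
  classical
  induction F using Finset.induction_on with
  | empty => simp
  | insert j F hj ih =>
    rw [Finset.prod_insert hj, Finset.prod_insert hj, Finset.sum_insert hj]
    have hB : |∏ i ∈ F, b i| ≤ 1 := by
      rw [Finset.abs_prod]
      exact Finset.prod_le_one (fun i _ => abs_nonneg _) fun i _ => hb i
    calc |a j * ∏ i ∈ F, a i - b j * ∏ i ∈ F, b i|
        = |a j * (∏ i ∈ F, a i - ∏ i ∈ F, b i) + (a j - b j) * ∏ i ∈ F, b i| := by ring_nf
      _ ≤ |a j| * |∏ i ∈ F, a i - ∏ i ∈ F, b i| + |a j - b j| * |∏ i ∈ F, b i| := by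
        rw [← abs_mul, ← abs_mul]; exact abs_add_le _ _
      _ ≤ 1 * |∏ i ∈ F, a i - ∏ i ∈ F, b i| + |a j - b j| * 1 := by
        gcongr
        exact ha j
      _ ≤ _ := by linarith

theorem enorm_prod_sub_prod_sq_le {ι : Type*} (F : Finset ι) {a b : ι → ℝ}
    (ha : ∀ i, |a i| ≤ 1) (hb : ∀ i, |b i| ≤ 1) :
    ‖∏ i ∈ F, a i - ∏ i ∈ F, b i‖ₑ ^ 2 ≤ F.card * ∑ i ∈ F, ‖a i - b i‖ₑ ^ 2 := by
  have h1 : |∏ i ∈ F, a i - ∏ i ∈ F, b i| ^ 2 ≤ F.card * ∑ i ∈ F, |a i - b i| ^ 2 :=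
    (pow_le_pow_left₀ (abs_nonneg _) (abs_prod_sub_prod_le_sum F ha hb) 2).trans
      sq_sum_le_card_mul_sum_sq
  have h2 : ∀ x : ℝ, ‖x‖ₑ ^ 2 = ENNReal.ofReal (|x| ^ 2) := by
    intro x
    rw [← ofReal_norm, Real.norm_eq_abs, ENNReal.ofReal_pow (abs_nonneg x)]
  simp_rw [h2]
  rw [← ENNReal.ofReal_sum_of_nonneg fun i _ => by positivity, ← ENNReal.ofReal_natCast,
    ← ENNReal.ofReal_mul (by positivity)]
  exact ENNReal.ofReal_le_ofReal h1

/-- The function of one variable that vanishes near each integer of `[-n, n]`, built from a cutoff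
`η` of the origin. -/
def combCutoff (η : ℝ → ℝ) (n : ℕ) (y : ℝ) : ℝ :=
  ∏ i ∈ Finset.Icc (-(n : ℤ)) n, (1 - η (y - i))

section CombCutoff

variable {η : ℝ → ℝ}

theorem IsPointCutoff.abs_one_sub_le (hη : IsPointCutoff η) (x : ℝ) : |1 - η x| ≤ 1 := by
  rw [abs_le]
  constructor <;> linarith [hη.nonneg x, hη.le_one x]

theorem combCutoff_contDiff (hη : IsPointCutoff η) (n : ℕ) :
    ContDiff ℝ (⊤ : ℕ∞) (combCutoff η n) :=
  contDiff_prod fun i _ => contDiff_const.sub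
    (hη.contDiff.comp (by fun_prop : ContDiff ℝ (⊤ : ℕ∞) fun y : ℝ => y - (i : ℝ)))

theorem enorm_combCutoff_le_one (hη : IsPointCutoff η) (n : ℕ) (y : ℝ) :
    ‖combCutoff η n y‖ₑ ≤ 1 := by
  rw [← ofReal_norm, ENNReal.ofReal_le_one, Real.norm_eq_abs, combCutoff, Finset.abs_prod]
  exact Finset.prod_le_one (fun i _ => abs_nonneg _) fun i _ => hη.abs_one_sub_le _

theorem combCutoff_eventually_eq_zero (hη : IsPointCutoff η) {n : ℕ} {i : ℤ}
    (hi : i ∈ Finset.Icc (-(n : ℤ)) n) : ∀ᶠ y in nhds (i : ℝ), combCutoff η n y = 0 := by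
  have h : Filter.Tendsto (fun y : ℝ => y - i) (nhds (i : ℝ)) (nhds 0) := by
    have : Continuous fun y : ℝ => y - i := by fun_prop
    simpa using this.tendsto (i : ℝ)
  filter_upwards [h.eventually hη.eventually_eq_one] with y hy
  exact Finset.prod_eq_zero hi (by rw [hy, sub_self])

theorem combCutoff_energy_le (hη : IsPointCutoff η) (n : ℕ) (r : ℝ) :
    slobodeckijEnergy volume r (combCutoff η n) ≤
      ((Finset.Icc (-(n : ℤ)) n).card : ℝ≥0∞) ^ 2 * slobodeckijEnergy volume r η := by
  set F := Finset.Icc (-(n : ℤ)) n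
  have hm : ∀ i : ℤ, Measurable fun y : ℝ => η (y - i) := fun i =>
    hη.contDiff.continuous.measurable.comp (measurable_id.sub_const _)
  have hpt : ∀ p : ℝ × ℝ, ‖combCutoff η n p.1 - combCutoff η n p.2‖ₑ ^ 2 / ‖p.1 - p.2‖ₑ ^ r ≤
      F.card * ∑ i ∈ F, ‖η (p.1 - i) - η (p.2 - i)‖ₑ ^ 2 / ‖p.1 - p.2‖ₑ ^ r := by
    intro p
    have h := enorm_prod_sub_prod_sq_le F (a := fun i : ℤ => 1 - η (p.1 - i))
      (b := fun i : ℤ => 1 - η (p.2 - i)) (fun i => hη.abs_one_sub_le _)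
      (fun i => hη.abs_one_sub_le _)
    simp only [sub_sub_sub_cancel_left] at h
    simp only [div_eq_mul_inv]
    rw [← Finset.sum_mul, ← mul_assoc]
    refine mul_le_mul_left (h.trans (le_of_eq ?_)) _
    congr 1
    refine Finset.sum_congr rfl fun i _ => ?_
    rw [← enorm_neg, neg_sub]
  refine (lintegral_mono hpt).trans (le_of_eq ?_)
  rw [lintegral_const_mul' _ _ (by simp), lintegral_finsetSum _
    fun i _ => measurable_slobodeckij (hm i) r]
  have h2 : ∀ i : ℤ, ∫⁻ p : ℝ × ℝ, ‖η (p.1 - i) - η (p.2 - i)‖ₑ ^ 2 / ‖p.1 - p.2‖ₑ ^ r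
      ∂(volume.prod volume) = slobodeckijEnergy volume r η := fun i =>
    slobodeckijEnergy_comp_sub r η (i : ℝ)
  simp_rw [h2]
  rw [Finset.sum_const, nsmul_eq_mul]
  ring

theorem lintegral_one_sub_combCutoff_le (hη : IsPointCutoff η) (n : ℕ) :
    ∫⁻ y, ‖1 - combCutoff η n y‖ₑ ^ 2 ≤
      ((Finset.Icc (-(n : ℤ)) n).card : ℝ≥0∞) ^ 2 * ∫⁻ y, ‖η y‖ₑ ^ 2 := by
  set F := Finset.Icc (-(n : ℤ)) n
  have hm : ∀ i : ℤ, Measurable fun y : ℝ => η (y - i) := fun i =>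
    hη.contDiff.continuous.measurable.comp (measurable_id.sub_const _)
  have hpt : ∀ y, ‖1 - combCutoff η n y‖ₑ ^ 2 ≤ F.card * ∑ i ∈ F, ‖η (y - i)‖ₑ ^ 2 := by
    intro y
    have h := enorm_prod_sub_prod_sq_le F (a := fun _ : ℤ => (1 : ℝ))
      (b := fun i : ℤ => 1 - η (y - i)) (fun i => by simp)
      (fun i => hη.abs_one_sub_le _)
    simp only [Finset.prod_const_one, sub_sub_cancel] at h
    exact h
  refine (lintegral_mono hpt).trans (le_of_eq ?_)
  rw [lintegral_const_mul' _ _ (by simp), lintegral_finsetSum _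
    fun i _ => (hm i).enorm.pow_const 2]
  have h2 : ∀ i : ℤ, ∫⁻ y, ‖η (y - i)‖ₑ ^ 2 = ∫⁻ y, ‖η y‖ₑ ^ 2 := fun i =>
    lintegral_sub_right_eq_self (fun y => ‖η y‖ₑ ^ 2) (i : ℝ)
  simp_rw [h2]
  rw [Finset.sum_const, nsmul_eq_mul]
  ring

end CombCutoff

theorem abs_coord_le_norm (p : Plane) (i : Fin 2) : |p i| ≤ ‖p‖ := by
  simpa using PiLp.norm_apply_le p i

theorem scaledBump_eq_zero {ρ : ℝ} (hρ : 0 < ρ) {p : Plane} (hp : ρ < ‖p‖) :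
    scaledBump ρ 0 p = 0 := by
  refine image_eq_zero_of_notMem_tsupport fun h => ?_
  have := scaledBump_tsupport hρ 0 h
  rw [mem_closedBall_zero_iff] at this
  linarith

theorem enorm_scaledBump_sq_le {ρ : ℝ} (hρ : 0 < ρ) (p : Plane) :
    ‖scaledBump ρ 0 p‖ₑ ^ 2 ≤ {p : Plane | |p 0| ≤ ρ}.indicator 1 p := by
  by_cases hp : p ∈ {p : Plane | |p 0| ≤ ρ}
  · rw [indicator_of_mem hp, Pi.one_apply]
    refine pow_le_one₀ zero_le ?_
    rw [← ofReal_norm, ENNReal.ofReal_le_one, Real.norm_of_nonneg (scaledBump_nonneg _ _ _)]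
    exact scaledBump_le_one _ _ _
  · have hp' : ρ < |p 0| := not_le.1 hp
    rw [scaledBump_eq_zero hρ (hp'.trans_le (abs_coord_le_norm p 0))]
    simp

/-- Cutting a bump off near the integer lines makes it a test function on the complement comb. -/
theorem isTestFunctionOn_combCutoff_mul {η : ℝ → ℝ} (hη : IsPointCutoff η) {ρ : ℝ} (hρ : 0 < ρ)
    {n : ℕ} (hn : ρ ≤ n) :
    IsTestFunctionOn complementComb (fun p => combCutoff η n (p 1) * scaledBump ρ 0 p) := by
  refine ⟨?_, (scaledBump_hasCompactSupport hρ 0).mul_left, fun p hp => ?_⟩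
  · exact ((combCutoff_contDiff hη n).comp
      (by fun_prop : ContDiff ℝ (⊤ : ℕ∞) fun p : Plane => p 1)).mul (scaledBump_contDiff ρ 0)
  · rw [mem_complementComb]
    right
    intro i hi
    have hpU : p ∈ tsupport (scaledBump ρ 0) := tsupport_mul_subset_right hp
    have hpn := scaledBump_tsupport hρ 0 hpU
    rw [mem_closedBall_zero_iff] at hpn
    have habs : |(i : ℝ)| ≤ n := by
      rw [← hi]
      linarith [abs_coord_le_norm p 1]
    have hiF : i ∈ Finset.Icc (-(n : ℤ)) n := by
      rw [abs_le] at habs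
      rw [Finset.mem_Icc]
      exact ⟨by exact_mod_cast habs.1, by exact_mod_cast habs.2⟩
    have hz := combCutoff_eventually_eq_zero hη hiF
    rw [← hi] at hz
    have hcont : Filter.Tendsto (fun q : Plane => q 1) (nhds p) (nhds (p 1)) :=
      (by fun_prop : Continuous fun q : Plane => q 1).tendsto p
    refine notMem_tsupport_iff_eventuallyEq.2 ?_ hp
    filter_upwards [hcont.eventually hz] with q hq
    simp [hq]

theorem combCutoff_mul_energy_le {η : ℝ → ℝ} (hη : IsPointCutoff η) {ρ : ℝ} (hρ : 0 < ρ)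
    (n : ℕ) {s : ℝ} (hs : 0 ≤ s) :
    slobodeckijEnergy volume (2 + 2 * s)
        (fun p : Plane => combCutoff η n (p 1) * scaledBump ρ 0 p) ≤
      2 * slobodeckijEnergy volume (2 + 2 * s) (scaledBump ρ 0) +
      2 * (ENNReal.ofReal (2 * ρ) * (ENNReal.ofReal Real.pi *
        slobodeckijEnergy volume (1 + 2 * s) (combCutoff η n))) := by
  have hUm : Measurable (scaledBump ρ 0) := (scaledBump_contDiff ρ 0).continuous.measurable
  have hgm : Measurable (combCutoff η n) := (combCutoff_contDiff hη n).continuous.measurable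
  have hpt : ∀ p : Plane × Plane,
      ‖combCutoff η n (p.1 1) * scaledBump ρ 0 p.1 -
        combCutoff η n (p.2 1) * scaledBump ρ 0 p.2‖ₑ ^ 2 / ‖p.1 - p.2‖ₑ ^ (2 + 2 * s) ≤
      2 * (‖scaledBump ρ 0 p.1 - scaledBump ρ 0 p.2‖ₑ ^ 2 / ‖p.1 - p.2‖ₑ ^ (2 + 2 * s)) +
      2 * ({p : Plane | |p 0| ≤ ρ}.indicator 1 p.1 *
        (‖combCutoff η n (p.1 1) - combCutoff η n (p.2 1)‖ₑ ^ 2 /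
          ‖p.1 - p.2‖ₑ ^ (2 + 2 * s))) := by
    intro p
    have e1 : combCutoff η n (p.1 1) * scaledBump ρ 0 p.1 -
        combCutoff η n (p.2 1) * scaledBump ρ 0 p.2 =
        combCutoff η n (p.2 1) * (scaledBump ρ 0 p.1 - scaledBump ρ 0 p.2) +
        scaledBump ρ 0 p.1 * (combCutoff η n (p.1 1) - combCutoff η n (p.2 1)) := by ring
    rw [e1, ← mul_div_assoc, ← mul_div_assoc, ← mul_div_assoc, ← ENNReal.add_div]
    refine ENNReal.div_le_div_right ((enorm_add_sq_le _ _).trans ?_) _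
    rw [enorm_mul, enorm_mul, mul_pow, mul_pow]
    gcongr
    · exact mul_le_of_le_one_left zero_le (pow_le_one₀ zero_le (enorm_combCutoff_le_one hη n _))
    · exact enorm_scaledBump_sq_le hρ p.1
  refine (lintegral_mono hpt).trans ?_
  rw [lintegral_add_left ((measurable_slobodeckij hUm _).const_mul 2),
    lintegral_const_mul' _ _ (by norm_num), lintegral_const_mul' _ _ (by norm_num)]
  gcongr
  · exact le_rfl
  · exact lintegral_slab_energy_le hs ρ hgm

theorem lintegral_scaledBump_le {η : ℝ → ℝ} (hη : IsPointCutoff η) {ρ : ℝ} (hρ : 0 < ρ) (n : ℕ) :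
    ∫⁻ p, ‖scaledBump ρ 0 p‖ₑ ^ 2 ≤
      2 * (∫⁻ p : Plane, ‖combCutoff η n (p 1) * scaledBump ρ 0 p‖ₑ ^ 2) +
      2 * (ENNReal.ofReal (2 * ρ) * ∫⁻ y, ‖1 - combCutoff η n y‖ₑ ^ 2) := by
  have hgm : Measurable (combCutoff η n) := (combCutoff_contDiff hη n).continuous.measurable
  have hψ : Measurable fun p : Plane => combCutoff η n (p 1) * scaledBump ρ 0 p :=
    (hgm.comp (by fun_prop : Continuous fun p : Plane => p 1).measurable).mul
      (scaledBump_contDiff ρ 0).continuous.measurable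
  rw [← lintegral_slab ρ (f := fun y => ‖1 - combCutoff η n y‖ₑ ^ 2)
      ((measurable_const.sub hgm).enorm.pow_const 2),
    ← lintegral_const_mul' _ _ (by norm_num), ← lintegral_const_mul' _ _ (by norm_num),
    ← lintegral_add_left ((hψ.enorm.pow_const 2).const_mul 2)]
  refine lintegral_mono fun p => ?_
  have e1 : scaledBump ρ 0 p = combCutoff η n (p 1) * scaledBump ρ 0 p +
      scaledBump ρ 0 p * (1 - combCutoff η n (p 1)) := by ring
  conv_lhs => rw [e1]
  refine (enorm_add_sq_le _ _).trans ?_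
  gcongr
  rw [enorm_mul, mul_pow]
  refine (mul_le_mul_left (enorm_scaledBump_sq_le hρ p) _).trans (le_of_eq ?_)
  simp only [indicator]
  split_ifs <;> simp

/-- For `s ≤ 1 / 2` the teeth of the comb are not seen by the energy: the eigenvalue of the
complement comb is bounded by the Rayleigh quotients of all bumps of the plane, which tend to `0`
under dilation. -/
theorem fracEigenvalue_complementComb {s : ℝ} (hs : 0 < s) (hs' : s ≤ 1 / 2) :
    fracEigenvalue s complementComb = 0 := by
  set l := fracEigenvalue s complementComb with hl
  have hs1 : s < 1 := by linarith
  have hlt : l ≠ ⊤ := by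
    intro htop
    have hball : Metric.ball (0 : Plane) 1 ⊆ complementComb := by
      intro p hp
      rw [mem_ball_zero_iff] at hp
      exact mem_complementComb.2 (Or.inl ((abs_coord_le_norm p 0).trans_lt hp))
    have htest := scaledBump_isTestFunctionOn one_pos hball
    have h1 := (fracEigenvalue_mul_le htest hs hs1).trans_lt (htest.energy_lt_top hs hs1)
    rw [← hl, htop, ENNReal.top_mul] at h1
    · exact lt_irrefl _ h1
    · rw [scaledBump_lintegral one_pos]
      simpa using planeBump_lintegral_pos.ne'
  refine eq_zero_of_mul_scaledBump_le hs hs1 (C := 4) (by norm_num) fun R => ?_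
  set ρ := max R 1
  have hρ : 0 < ρ := lt_of_lt_of_le one_pos (le_max_right R 1)
  refine ⟨ρ, 0, hρ, le_max_left R 1, ?_⟩
  obtain ⟨n, hn⟩ := exists_nat_ge ρ
  set m : ℝ≥0∞ := ((Finset.Icc (-(n : ℤ)) n).card : ℝ≥0∞) ^ 2 with hm
  have hmt : m ≠ ⊤ := ENNReal.pow_ne_top (by simp)
  set w := ENNReal.ofReal (2 * ρ)
  set E := slobodeckijEnergy volume (2 + 2 * s) (scaledBump ρ 0)
  set c : ℝ≥0∞ := 4 * (w * (ENNReal.ofReal Real.pi * m)) + 2 * (l * (w * m)) with hc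
  have hct : c ≠ ⊤ := by
    have hwt : w ≠ ⊤ := ENNReal.ofReal_ne_top
    refine ENNReal.add_ne_top.2 ⟨?_, ?_⟩
    · exact ENNReal.mul_ne_top (by norm_num) (ENNReal.mul_ne_top hwt
        (ENNReal.mul_ne_top ENNReal.ofReal_ne_top hmt))
    · exact ENNReal.mul_ne_top (by norm_num) (ENNReal.mul_ne_top hlt (ENNReal.mul_ne_top hwt hmt))
  have key : ∀ δ : ℝ≥0∞, 0 < δ → l * ∫⁻ x, ‖scaledBump ρ 0 x‖ₑ ^ 2 ≤ 4 * E + c * δ := by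
    intro δ hδ
    obtain ⟨η, hη, hηE, hηI⟩ := exists_isPointCutoff_energy_le (r := 1 + 2 * s) (by linarith)
      (by linarith) hδ
    have h1 := fracEigenvalue_mul_le (isTestFunctionOn_combCutoff_mul hη hρ hn) hs hs1
    have h2 := combCutoff_mul_energy_le hη hρ n hs.le
    have h3 : slobodeckijEnergy volume (1 + 2 * s) (combCutoff η n) ≤ m * δ :=
      (combCutoff_energy_le hη n _).trans (by gcongr)
    have h4 : ∫⁻ y, ‖1 - combCutoff η n y‖ₑ ^ 2 ≤ m * δ :=
      (lintegral_one_sub_combCutoff_le hη n).trans (by gcongr)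
    set P := ∫⁻ p : Plane, ‖combCutoff η n (p 1) * scaledBump ρ 0 p‖ₑ ^ 2
    calc l * ∫⁻ x, ‖scaledBump ρ 0 x‖ₑ ^ 2
        ≤ l * (2 * P + 2 * (w * (m * δ))) := by
          gcongr
          exact (lintegral_scaledBump_le hη hρ n).trans (by gcongr)
      _ = 2 * (l * P) + 2 * (l * (w * m)) * δ := by ring
      _ ≤ 2 * (2 * E + 2 * (w * (ENNReal.ofReal Real.pi * (m * δ)))) +
          2 * (l * (w * m)) * δ := by
          gcongr
          exact h1.trans (h2.trans (by gcongr))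
      _ = 4 * E + c * δ := by rw [hc]; ring
  have hcont : Continuous fun δ : ℝ≥0∞ => 4 * E + c * δ :=
    continuous_const.add (ENNReal.continuous_const_mul hct)
  have hlim := (hcont.tendsto 0).mono_left (nhdsWithin_le_nhds (s := Ioi 0))
  simp only [mul_zero, add_zero] at hlim
  exact ge_of_tendsto hlim (by filter_upwards [self_mem_nhdsWithin] with δ hδ using key δ hδ)

end

theorem corollary6p1 :
    (∀ Ω : Set (EuclideanSpace ℝ (Fin 2)), IsOpen Ω → IsSimplyConnected Ω →
      ∀ s : ℝ, 1 / 2 < s → s < 1 → (0 < fracEigenvalue s Ω ↔ inradius Ω < ⊤)) ∧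
    (∀ s : ℝ, 0 < s → s ≤ 1 / 2 →
      (∀ Ω : Set (EuclideanSpace ℝ (Fin 2)), IsOpen Ω → IsSimplyConnected Ω →
        0 < fracEigenvalue s Ω → inradius Ω < ⊤) ∧
      ¬ (∀ Ω : Set (EuclideanSpace ℝ (Fin 2)), IsOpen Ω → IsSimplyConnected Ω →
        inradius Ω < ⊤ → 0 < fracEigenvalue s Ω)) ∧
    (IsOpen complementComb ∧ IsSimplyConnected complementComb ∧ inradius complementComb < ⊤ ∧
      ∀ s : ℝ, 0 < s → s ≤ 1 / 2 → fracEigenvalue s complementComb = 0) := by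
  refine ⟨fun Ω hΩ hsc s hs hs1 => ⟨inradius_lt_top_of_fracEigenvalue_pos (by linarith) hs1,
    fracEigenvalue_pos_of_inradius_lt_top hs hΩ hsc⟩, fun s hs hs' => ⟨fun Ω _ _ =>
    inradius_lt_top_of_fracEigenvalue_pos hs (by linarith), fun h => ?_⟩,
    isOpen_complementComb, isSimplyConnected_complementComb, inradius_complementComb_lt_top,
    fun s hs hs' => fracEigenvalue_complementComb hs hs'⟩
  exact (h complementComb isOpen_complementComb isSimplyConnected_complementComb
    inradius_complementComb_lt_top).ne' (fracEigenvalue_complementComb hs hs')
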